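/- Let $v:\mathbb Z\to\mathbb R$ have finite support, and work on $\ell^2(\mathbb Z)$. Let $(Rf)_n=f_{n-1}$, $L=R^*$ (so $(Lf)_n=f_{n+1}$), $(Hf)_n=f_{n+1}+f_{n-1}+v_nf_n$, and let $H_0$ be $H$ with $v\equiv 0$. For $z\in\mathbb C^+=\{\operatorname{Im}z>0\}$ put $$\tilde\lambda(z)=\frac{z-\sqrt{z^2-4}}2,\qquad \lambda_n(z)=\frac{z-v_n-\sqrt{(z-v_n)^2-4}}2,$$ where $\sqrt{\ }$ has its cut along $[0,\infty)$ and takes values in the upper half-plane. Let $\Lambda=\Lambda(z)$ and $\Omega=\Omega(z)$ be the diagonal operators with entries $\lambda_n(z)$ and $\lambda_{n+1}(z)-\lambda_n(z)$. For a trace class operator $A$, $\det(I+A)$ is the Fredholm determinant; for a Hilbert--Schmidt operator $A$, $\det_2(I+A)=\det(I+R_2(A))$ with $R_2(A)=(I+A)e^{-A}-I$. The quotient $(H-z)/(H_0-z)$ denotes $(H_0-z)^{-1}(H-z)$. Set $$T(z)=\Omega L(L-\Lambda)^{-1}(R-\Lambda)^{-1}(R\Omega+\Omega L)(R-\Lambda)^{-1}(L-\Lambda)^{-1},$$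 $$P(z)=\det{}_2\!\left[I+\Omega L(R-\Lambda)^{-1}(L-\Lambda)^{-1}\right]\det{}_2\!\left[I-\Omega L(L-\Lambda)^{-1}(R-\Lambda)^{-1}\right].$$ Then for every $z\in\mathbb C^+$ the operators $H_0-z$, $L-\Lambda$ and $R-\Lambda$ are boundedly invertible, $(H_0-z)^{-1}(H-z)-I$ and $T(z)$ are trace class, and the two operators $\Omega L(R-\Lambda)^{-1}(L-\Lambda)^{-1}$ and $-\Omega L(L-\Lambda)^{-1}(R-\Lambda)^{-1}$ in $P(z)$ are Hilbert--Schmidt with trace class images under $R_2$. There is a holomorphic function $P^{1/2}$ on $\mathbb C^+$ with $(P^{1/2})^2=P$ and $P^{1/2}(z)\to1$ as $\operatorname{Im}z\to\infty$, and for every such function and every $z\in\mathbb C^+$ $$\det\left[\frac{H-z}{H_0-z}\right]=\prod_{j=-\infty}^{\infty}\frac{\tilde\lambda(z)}{\lambda_j(z)}\cdot a_m(z),\qquad a_m(z)=\exp\!\left(\tfrac12\operatorname{tr}T(z)\right)P(z)^{1/2}.$$ -/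

import Mathlib

open Filter Topology
open scoped ENNReal

noncomputable section

namespace JacobiDet

/-! ### Operators on `ℓ²(ℤ)` -/

/-- The complex Hilbert space `ℓ²(ℤ)`. -/
abbrev L2Z : Type := lp (fun _ : ℤ => ℂ) 2

/-- Bounded operators on `ℓ²(ℤ)`. -/
abbrev Op : Type := L2Z →L[ℂ] L2Z

/-- The standard basis vector `e_n` of `ℓ²(ℤ)`. -/
def basisVec (n : ℤ) : L2Z := lp.single 2 n (1 : ℂ)

/-- The translation `(translate k f)_n = f_{n+k}`. -/
def translate (k : ℤ) : Op :=
  LinearMap.mkContinuous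
    { toFun := fun f => ⟨fun n => f (n + k), by
        have h := (lp.memℓp f).summable (by norm_num)
        exact memℓp_gen ((Equiv.addRight k).summable_iff.mpr h)⟩
      map_add' := fun _ _ => rfl
      map_smul' := fun _ _ => rfl }
    1
    fun f => by
      have h2 : (0 : ℝ) < (2 : ℝ≥0∞).toReal := by norm_num
      rw [one_mul, lp.norm_eq_tsum_rpow h2, lp.norm_eq_tsum_rpow h2]
      exact le_of_eq (congrArg (fun t : ℝ => t ^ (1 / (2 : ℝ≥0∞).toReal))
        ((Equiv.addRight k).tsum_eq fun n => ‖f n‖ ^ (2 : ℝ≥0∞).toReal))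

@[simp]
theorem translate_apply (k : ℤ) (f : L2Z) (n : ℤ) : translate k f n = f (n + k) := rfl

/-- The right shift `(R f)_n = f_{n-1}`. -/
def R : Op := translate (-1)

/-- The left shift `L = R*`. -/
def L : Op := ContinuousLinearMap.adjoint R

/-- The left shift is `(L f)_n = f_{n+1}`. -/
theorem L_eq_translate : L = translate 1 := by
  unfold L
  symm
  rw [ContinuousLinearMap.eq_adjoint_iff]
  intro f g
  rw [lp.inner_eq_tsum, lp.inner_eq_tsum, ← (Equiv.addRight (-1 : ℤ)).tsum_eq]
  simp [R]

open Classical in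
/-- The diagonal operator `(diag a f)_n = a_n f_n` of a bounded sequence `a`
(with the value `0` for unbounded `a`). -/
def diag (a : ℤ → ℂ) : Op :=
  if h : ∃ K : ℝ, 0 ≤ K ∧ ∀ n, ‖a n • ContinuousLinearMap.id ℂ ℂ‖ ≤ K then
    lp.mapCLM 2 (fun n => a n • ContinuousLinearMap.id ℂ ℂ) h.choose_spec.1 h.choose_spec.2
  else 0

theorem diag_apply {a : ℤ → ℂ} (h : (Set.range a).Finite) (f : L2Z) (n : ℤ) :
    diag a f n = a n * f n := by
  have hb : ∃ K : ℝ, 0 ≤ K ∧ ∀ n, ‖a n • ContinuousLinearMap.id ℂ ℂ‖ ≤ K := by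
    obtain ⟨K, hK⟩ := (h.image norm).bddAbove
    refine ⟨max K 0, le_max_right _ _, fun n => ?_⟩
    have h1 : ‖a n‖ ≤ K := hK ⟨a n, ⟨n, rfl⟩, rfl⟩
    rw [norm_smul, ContinuousLinearMap.norm_id, mul_one]
    exact h1.trans (le_max_left _ _)
  unfold diag
  rw [dif_pos hb]
  simp

/-! ### Hilbert–Schmidt and trace class operators, traces and determinants -/

/-- The Hilbert–Schmidt class `S₂`: `∑ₙ ‖A eₙ‖² < ∞`. -/
def IsHilbertSchmidt (A : Op) : Prop :=
  Summable fun n : ℤ => ‖A (basisVec n)‖ ^ 2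

/-- The trace class `S₁`: products of two Hilbert–Schmidt operators. -/
def IsTraceClass (A : Op) : Prop :=
  ∃ B C : Op, IsHilbertSchmidt B ∧ IsHilbertSchmidt C ∧ A = B * C

/-- The matrix entry `⟨e_i, A e_j⟩`. -/
def entry (A : Op) (i j : ℤ) : ℂ := A (basisVec j) i

/-- The trace `tr A = ∑ₙ ⟨eₙ, A eₙ⟩` of a trace class operator `A`. -/
def trace (A : Op) : ℂ := ∑' n : ℤ, entry A n n

/-- The Fredholm determinant `det (I + A)` of a trace class operator `A`, that is
`∑ₖ tr (⋀ᵏ A)`. The vectors `e_{i₁} ∧ ⋯ ∧ e_{iₖ}`, `i₁ < ⋯ < iₖ`, form an orthonormal basis of the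
`k`-th exterior power, so this is the absolutely convergent sum of all finite principal minors of
the matrix of `A`. -/
def detOneAdd (A : Op) : ℂ :=
  ∑' S : Finset ℤ, (Matrix.of fun i j : S => entry A i j).det

/-- `R₂(A) = (I + A) exp(-A) - I`. -/
def R₂ (A : Op) : Op := (1 + A) * NormedSpace.exp (-A) - 1

/-- The regularized determinant `det₂ (I + A) = det (I + R₂(A))` of a Hilbert–Schmidt
operator `A`. -/
def det₂OneAdd (A : Op) : ℂ := detOneAdd (R₂ A)

/-! ### The Schrödinger operator and the diagonal operators `Λ`, `Ω` -/

/-- The discrete Schrödinger operator `(H f)_n = f_{n+1} + f_{n-1} + v_n f_n`. -/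
def H (v : ℤ → ℝ) : Op := L + R + diag fun n => (v n : ℂ)

/-- The square root with cut along the positive half-line (values in the upper half-plane). -/
def sqrtPos (w : ℂ) : ℂ := Complex.I * (-w) ^ (1 / 2 : ℂ)

theorem sqrtPos_sq (w : ℂ) : sqrtPos w ^ 2 = w := by
  unfold sqrtPos
  rw [mul_pow, Complex.I_sq, ← Complex.cpow_nat_mul]
  norm_num

/-- `λ̃(z) = (z - √(z² - 4)) / 2`. -/
def lam0 (z : ℂ) : ℂ := (z - sqrtPos (z ^ 2 - 4)) / 2

/-- `λ_n(z) = (z - v_n - √((z - v_n)² - 4)) / 2`. -/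
def lam (v : ℤ → ℝ) (z : ℂ) (n : ℤ) : ℂ := (z - v n - sqrtPos ((z - v n) ^ 2 - 4)) / 2

/-- `Λ(z) = diag (λ_n(z))`. -/
def Lam (v : ℤ → ℝ) (z : ℂ) : Op := diag (lam v z)

/-- `Ω(z) = diag (ω_n(z))`, `ω_n = λ_{n+1} - λ_n`. -/
def Om (v : ℤ → ℝ) (z : ℂ) : Op := diag fun n => lam v z (n + 1) - lam v z n

/-- `(L - Λ)⁻¹`. -/
def LInv (v : ℤ → ℝ) (z : ℂ) : Op := Ring.inverse (L - Lam v z)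

/-- `(R - Λ)⁻¹`. -/
def RInv (v : ℤ → ℝ) (z : ℂ) : Op := Ring.inverse (R - Lam v z)

/-- `(H₀ - z)⁻¹ (H - z) - I`, so that `det [(H - z)/(H₀ - z)]` is `det (I + pert v z)`. -/
def pert (v : ℤ → ℝ) (z : ℂ) : Op :=
  Ring.inverse (H 0 - z • (1 : Op)) * (H v - z • (1 : Op)) - 1

/-- The perturbation determinant `det [(H - z)/(H₀ - z)]`. -/
def pertDet (v : ℤ → ℝ) (z : ℂ) : ℂ := detOneAdd (pert v z)

/-- The WKB product `∏_{j ∈ ℤ} λ̃(z)/λ_j(z)`; only finitely many factors differ from `1` when `v` is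
finitely supported. -/
def wkb (v : ℤ → ℝ) (z : ℂ) : ℂ := ∏ᶠ j : ℤ, lam0 z / lam v z j

/-- `Ω L (L-Λ)⁻¹ (R-Λ)⁻¹ (RΩ + ΩL) (R-Λ)⁻¹ (L-Λ)⁻¹`. -/
def traceOp (v : ℤ → ℝ) (z : ℂ) : Op :=
  Om v z * L * LInv v z * RInv v z * (R * Om v z + Om v z * L) * RInv v z * LInv v z

/-- `A = Ω L (R-Λ)⁻¹ (L-Λ)⁻¹`. -/
def opA (v : ℤ → ℝ) (z : ℂ) : Op := Om v z * L * RInv v z * LInv v z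

/-- `B = Ω L (L-Λ)⁻¹ (R-Λ)⁻¹`. -/
def opB (v : ℤ → ℝ) (z : ℂ) : Op := Om v z * L * LInv v z * RInv v z

/-- `det₂ (I + A) · det₂ (I - B)`. -/
def det₂Prod (v : ℤ → ℝ) (z : ℂ) : ℂ := det₂OneAdd (opA v z) * det₂OneAdd (-opB v z)

/-- `s` is the branch on the upper half-plane of the square root of `P`: holomorphic there, with
square `P`, and tending to `1` as `Im z → ∞`. -/
structure IsSqrtBranch (P s : ℂ → ℂ) : Prop where
  holomorphic : DifferentiableOn ℂ s {z : ℂ | 0 < z.im}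
  sq_eq : ∀ z : ℂ, 0 < z.im → s z ^ 2 = P z
  tendsto_one : Tendsto s (comap Complex.im atTop) (𝓝 1)

/-- The modified coefficient `a_m(z)`, where `s` is the square root of `det₂ (I + A) det₂ (I - B)`. -/
def aMod (v : ℤ → ℝ) (s : ℂ → ℂ) (z : ℂ) : ℂ :=
  Complex.exp (1 / 2 * trace (traceOp v z)) * s z

end JacobiDet

end

/-! ### Finite matrices: principal minors and the determinant of an exponential. -/

namespace Matrix

variable {n : Type*} [Fintype n] [DecidableEq n]

/-! Write A for `opA`, B for `opB`, λ̃ for `lam0 z`. Outside a finite set the potential vanishes, so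
λ_n = λ̃ there and Ω has finite support. Hence A, B and `traceOp` take values in sequences supported
in a finite set F (`RowsIn`), and their traces and determinants are those of the F × F compressions.

The algebra rests on λ_n² - (z - v_n) λ_n + 1 = 0 and on ΩL = LΛ - ΛL. They give (1 + A)(L - Λ)(R -
Λ) = -Λ(H - z) and (1 - B)(R - Λ)(L - Λ) = -(H - z)Λ (`one_add_opA_mul`, `one_sub_opB_mul`), and for
v = 0 the factorization H₀ - z = -λ̃⁻¹(L - λ̃)(R - λ̃). Dividing by the free identity leaves the
quotients of L - Λ by L - λ̃ and of R - Λ by R - λ̃. Each is the identity plus a strictly triangular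
operator, so it has determinant 1 (`detOneAdd_eq_of_factor`). Therefore det(1 + A) and det(1 - B)
both equal ∏ λ_j/λ̃ times the perturbation determinant (`detOneAdd_opA`, `detOneAdd_neg_opB`).

Since det₂(1 + X) = det(1 + X) exp(-tr X) and T = A - B (`traceOp_eq`), P = (det(1 + A) exp(-tr T /
2))². As Im z → ∞, Λ → 0 and the base of this square tends to 1, so by connectedness it is the
required branch (`IsSqrtBranch.unique`). The factor exp(tr T / 2) then cancels. -/

/-- `det (1 + M)` is the sum of all principal minors of `M`. -/
theorem det_one_add_eq_sum_minors {R : Type*} [CommRing R] (M : Matrix n n R) :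
    (1 + M).det = ∑ s : Finset n, (M.submatrix ((↑) : s → n) ((↑) : s → n)).det := by
  rw [add_comm]
  change detRowAlternating (fun i => M i + (1 : Matrix n n R) i) = _
  have := (detRowAlternating (R := R) (n := n)).map_add_univ (fun i => M i) (fun i => (1 : Matrix n n R) i)
  refine this.trans (Finset.sum_congr rfl fun s _ => ?_)
  exact det_piecewise_one_eq_submatrix_det M s

section
attribute [local instance] Matrix.linftyOpNormedRing Matrix.linftyOpNormedAlgebra

theorem differentiable_det : Differentiable ℂ (det : Matrix n n ℂ → ℂ) := by
  have h : (det : Matrix n n ℂ → ℂ) =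
      fun M => ∑ σ : Equiv.Perm n, (Equiv.Perm.sign σ : ℂ) * ∏ i, M (σ i) i := by
    funext M; rw [det_apply']
  have he : ∀ i j, Differentiable ℂ (fun M : Matrix n n ℂ => M i j) := fun i j =>
    (LinearMap.toContinuousLinearMap (entryLinearMap ℂ ℂ i j)).differentiable
  rw [h]
  refine Differentiable.fun_sum fun σ _ => Differentiable.const_mul ?_ _
  intro M
  exact (HasFDerivAt.finsetProd fun i _ => (he (σ i) i M).hasFDerivAt).differentiableAt

/-- The derivative along the line t ↦ 1 + tA is computed twice: by the chain rule, and from det(1 +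
tA) = 1 + t tr A + O(t²), where the polynomial `p` carries the terms of order at least two. -/
theorem fderiv_det_one_apply (A : Matrix n n ℂ) :
    fderiv ℂ (det : Matrix n n ℂ → ℂ) 1 A = A.trace := by
  have h1 : HasDerivAt (fun t : ℂ => (1 + t • A).det) (fderiv ℂ (det : Matrix n n ℂ → ℂ) 1 A) 0 := by
    have h2 : HasDerivAt (fun t : ℂ => 1 + t • A) A 0 := by
      exact (((hasDerivAt_id (0 : ℂ)).smul_const A).const_add 1).congr_deriv (one_smul ℂ A)
    have h3 := (differentiable_det (n := n) (1 + (0 : ℂ) • A)).hasFDerivAt.comp_hasDerivAt 0 h2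
    simpa using! h3
  have h4 : HasDerivAt (fun t : ℂ => (1 + t • A).det) A.trace 0 := by
    set p : Polynomial ℂ := (det (1 + (Polynomial.X : Polynomial ℂ) • A.map Polynomial.C)).divX.divX
    have h5 := (((hasDerivAt_id (0 : ℂ)).const_mul A.trace).const_add 1).add
      ((p.hasDerivAt 0).mul ((hasDerivAt_id (0 : ℂ)).pow 2))
    have h6 : (fun t : ℂ => (1 + t • A).det) =
        fun t => 1 + A.trace * t + p.eval t * t ^ 2 := funext fun t => det_one_add_smul t A
    rw [h6]
    exact h5.congr_deriv (by simp)
  exact h1.unique h4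

/-- `det (exp A) = exp (tr A)` for complex matrices. -/
theorem det_exp (A : Matrix n n ℂ) : (NormedSpace.exp A).det = Complex.exp A.trace := by
  have hE : ∀ t : ℂ, HasDerivAt (fun s : ℂ => (NormedSpace.exp (s • A)).det)
      ((NormedSpace.exp (t • A)).det * A.trace) t := by
    intro t
    have h0 : HasDerivAt (fun s : ℂ => NormedSpace.exp (s • A)) A 0 := by
      simpa using! hasDerivAt_exp_smul_const (𝕂 := ℂ) A (0 : ℂ)
    -- The derivative at `t` is transported from 0 by det exp(sA) = det exp(tA) · det exp((s - t)A);
    -- `t - t` is 0 in the form that the shift of variable expects.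
    have h1 : HasDerivAt (fun s : ℂ => (NormedSpace.exp (s • A)).det) A.trace (t - t) := by
      rw [sub_self, ← fderiv_det_one_apply A]
      have h3 := (differentiable_det (n := n)
        (NormedSpace.exp ((0 : ℂ) • A))).hasFDerivAt.comp_hasDerivAt 0 h0
      simpa using! h3
    have h2 := (h1.comp_sub_const t t).const_mul (NormedSpace.exp (t • A)).det
    have h3 : (fun s : ℂ => (NormedSpace.exp (s • A)).det) =
        fun s => (NormedSpace.exp (t • A)).det * (NormedSpace.exp ((s - t) • A)).det := by
      funext s
      rw [← det_mul, ← exp_add_of_commute]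
      · congr 2; rw [← add_smul]; congr 1; ring
      · exact ((Commute.refl A).smul_left _).smul_right _
    rw [h3]
    exact h2
  have hc : ∀ t : ℂ, HasDerivAt (fun s : ℂ => (NormedSpace.exp (s • A)).det *
      Complex.exp (-(s * A.trace))) 0 t := by
    intro t
    have h1 := ((hasDerivAt_id t).mul_const A.trace).neg.cexp
    refine ((hE t).mul h1).congr_deriv ?_
    simp only [id, Pi.neg_apply]
    ring
  have := is_const_of_deriv_eq_zero (fun t => (hc t).differentiableAt) (fun t => (hc t).deriv) 1 0
  simp only [one_smul, one_mul, zero_smul, NormedSpace.exp_zero, det_one, zero_mul, neg_zero,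
    Complex.exp_zero] at this
  rw [Complex.exp_neg] at this
  exact (mul_inv_eq_one₀ (Complex.exp_ne_zero _)).mp this

end

end Matrix

noncomputable section

namespace JacobiDet

/-! ### Operators whose range consists of sequences supported in a finite set -/

/-- The matrix entry as a continuous linear functional. -/
def coordCLM (f : L2Z) (n : ℤ) : Op →L[ℂ] ℂ :=
  LinearMap.mkContinuous
    { toFun := fun X => X f n
      map_add' := fun _ _ => rfl
      map_smul' := fun _ _ => rfl } ‖f‖ fun X => by
    rw [mul_comm]
    exact (lp.norm_apply_le_norm (by norm_num) (X f) n).trans (X.le_opNorm f)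

@[simp] theorem coordCLM_apply (f : L2Z) (n : ℤ) (X : Op) : coordCLM f n X = X f n := rfl

theorem basisVec_apply (n m : ℤ) : basisVec n m = if m = n then 1 else 0 := by
  unfold basisVec
  rw [lp.single_apply]
  by_cases h : m = n
  · subst h; simp
  · simp [h]

theorem eq_sum_basisVec {F : Finset ℤ} {f : L2Z} (h : ∀ n ∉ F, f n = 0) :
    f = ∑ k ∈ F, f k • basisVec k := by
  ext n
  rw [lp.coeFn_sum, Finset.sum_apply]
  simp only [lp.coeFn_smul, Pi.smul_apply, basisVec_apply, smul_eq_mul, mul_ite, mul_one, mul_zero]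
  rw [Finset.sum_ite_eq]
  split_ifs with hn
  · rfl
  · exact h n hn

/-- The matrix of the compression of `X` to the coordinates in `F`. -/
def compress (F : Finset ℤ) (X : Op) : Matrix F F ℂ := Matrix.of fun i j => entry X i j

@[simp] theorem compress_apply (F : Finset ℤ) (X : Op) (i j : F) :
    compress F X i j = entry X i j := rfl

/-- `X` takes values in the sequences supported in `F`. -/
def RowsIn (F : Finset ℤ) (X : Op) : Prop := ∀ f : L2Z, ∀ n ∉ F, X f n = 0

/-- `X` vanishes on the basis vectors outside `F`. -/
def ColsIn (F : Finset ℤ) (X : Op) : Prop := ∀ n ∉ F, X (basisVec n) = 0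

theorem RowsIn.mul_right {F : Finset ℤ} {X : Op} (h : RowsIn F X) (Y : Op) : RowsIn F (X * Y) :=
  fun f n hn => h (Y f) n hn

theorem RowsIn.add {F : Finset ℤ} {X Y : Op} (h : RowsIn F X) (h' : RowsIn F Y) :
    RowsIn F (X + Y) := fun f n hn => by
  change X f n + Y f n = 0
  rw [h f n hn, h' f n hn, add_zero]

theorem RowsIn.neg {F : Finset ℤ} {X : Op} (h : RowsIn F X) : RowsIn F (-X) := fun f n hn => by
  change -(X f n) = 0
  rw [h f n hn, neg_zero]

theorem RowsIn.sub {F : Finset ℤ} {X Y : Op} (h : RowsIn F X) (h' : RowsIn F Y) :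
    RowsIn F (X - Y) := by
  rw [sub_eq_add_neg]; exact h.add h'.neg

theorem RowsIn.mono {F G : Finset ℤ} (hFG : F ⊆ G) {X : Op} (h : RowsIn F X) : RowsIn G X :=
  fun f n hn => h f n fun h' => hn (hFG h')

theorem ColsIn.mul_left {F : Finset ℤ} {X : Op} (h : ColsIn F X) (Y : Op) : ColsIn F (Y * X) :=
  fun n hn => by
    change Y (X (basisVec n)) = 0
    rw [h n hn, map_zero]

theorem entry_mul_of_rowsIn {F : Finset ℤ} (X : Op) {Y : Op} (h : RowsIn F Y) (i j : ℤ) :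
    entry (X * Y) i j = ∑ k ∈ F, entry X i k * entry Y k j := by
  change X (Y (basisVec j)) i = _
  rw [eq_sum_basisVec (h (basisVec j)), map_sum, lp.coeFn_sum, Finset.sum_apply]
  refine Finset.sum_congr rfl fun k _ => ?_
  rw [map_smul, lp.coeFn_smul, Pi.smul_apply, smul_eq_mul, mul_comm]
  rfl

/-- Only the right factor needs its rows in `F`: that already confines the intermediate index of the
matrix product to `F`. -/
theorem compress_mul {F : Finset ℤ} (X : Op) {Y : Op} (h : RowsIn F Y) :
    compress F (X * Y) = compress F X * compress F Y := by
  ext i j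
  rw [compress_apply, entry_mul_of_rowsIn X h, Matrix.mul_apply]
  exact (Finset.sum_coe_sort F fun k => entry X i k * entry Y k j).symm

theorem compress_add (F : Finset ℤ) (X Y : Op) :
    compress F (X + Y) = compress F X + compress F Y := rfl

theorem compress_sub (F : Finset ℤ) (X Y : Op) :
    compress F (X - Y) = compress F X - compress F Y := rfl

theorem compress_neg (F : Finset ℤ) (X : Op) : compress F (-X) = -compress F X := rfl

theorem compress_smul (F : Finset ℤ) (c : ℂ) (X : Op) :
    compress F (c • X) = c • compress F X := rfl

theorem compress_one (F : Finset ℤ) : compress F 1 = 1 := by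
  ext i j
  rw [compress_apply, Matrix.one_apply]
  change basisVec j i = _
  rw [basisVec_apply]
  exact if_congr Subtype.ext_iff.symm rfl rfl

theorem continuous_compress (F : Finset ℤ) : Continuous (compress F) :=
  continuous_matrix fun i j => (coordCLM (basisVec j) i).continuous

/-! ### The coordinate projections -/

/-- The projection to the coordinates in `F`. -/
def proj (F : Finset ℤ) : Op := diag fun n => if n ∈ F then 1 else 0

theorem proj_apply (F : Finset ℤ) (f : L2Z) (n : ℤ) : proj F f n = if n ∈ F then f n else 0 := by
  unfold proj
  rw [diag_apply]
  · simp
  · refine (Set.toFinite {0, 1}).subset ?_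
    rintro _ ⟨n, rfl⟩
    by_cases h : n ∈ F <;> simp [h]

theorem rowsIn_proj (F : Finset ℤ) : RowsIn F (proj F) := fun f n hn => by
  rw [proj_apply, if_neg hn]

theorem RowsIn.proj_mul {F : Finset ℤ} {X : Op} (h : RowsIn F X) : proj F * X = X := by
  ext f n
  change proj F (X f) n = X f n
  rw [proj_apply]
  split_ifs with hn
  · rfl
  · exact (h f n hn).symm

/-- By continuity X f = ∑ f_n X e_n, and only the terms with n in `F` survive. -/
theorem ColsIn.mul_proj {F : Finset ℤ} {X : Op} (h : ColsIn F X) : X * proj F = X := by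
  ext f : 1
  change X (proj F f) = X f
  have h1 : HasSum (fun n : ℤ => f n • X (basisVec n)) (X f) := by
    have := (lp.hasSum_single (by norm_num) f).mapL X
    refine this.congr_fun ?_ 
    intro n
    rw [← map_smul]
    unfold basisVec
    rw [← lp.single_smul, smul_eq_mul, mul_one]
  have h2 : HasSum (fun n : ℤ => f n • X (basisVec n)) (∑ n ∈ F, f n • X (basisVec n)) :=
    hasSum_sum_of_ne_finset_zero fun n hn => by rw [h n hn, smul_zero]
  rw [h1.unique h2, eq_sum_basisVec (rowsIn_proj F f), map_sum]
  refine Finset.sum_congr rfl fun n hn => ?_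
  rw [proj_apply, if_pos hn, map_smul]

theorem compress_mul_proj (F : Finset ℤ) (X : Op) : compress F (X * proj F) = compress F X := by
  ext i j
  change X (proj F (basisVec j)) i = X (basisVec j) i
  suffices h : proj F (basisVec j) = basisVec j by rw [h]
  ext n
  rw [proj_apply, basisVec_apply]
  split_ifs with h1 h2 h2
  · rfl
  · rfl
  · exact absurd (h2 ▸ j.2) h1
  · rfl

theorem compress_proj_mul (F : Finset ℤ) (X : Op) : compress F (proj F * X) = compress F X := by
  ext i j
  change proj F (X (basisVec j)) i = X (basisVec j) i
  rw [proj_apply, if_pos i.2]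

/-! ### Hilbert–Schmidt and trace class operators of finite rank -/

theorem ColsIn.isHilbertSchmidt {F : Finset ℤ} {X : Op} (h : ColsIn F X) : IsHilbertSchmidt X :=
  summable_of_ne_finset_zero (s := F) fun n hn => by simp [h n hn]

/-- Row `i` of X is the complex conjugate of the vector X* e_i, which lies in ℓ². -/
theorem summable_norm_entry_sq (X : Op) (i : ℤ) : Summable fun n : ℤ => ‖entry X i n‖ ^ 2 := by
  have h : ∀ n, ‖entry X i n‖ = ‖ContinuousLinearMap.adjoint X (basisVec i) n‖ := fun n => by
    have h1 := ContinuousLinearMap.adjoint_inner_left X (basisVec n) (basisVec i)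
    unfold basisVec at h1
    rw [lp.inner_single_left, lp.inner_single_right] at h1
    simp only [RCLike.inner_apply, one_mul, map_one, mul_one] at h1
    unfold entry basisVec
    rw [← h1, RCLike.norm_conj]
  simp_rw [h]
  have := (lp.memℓp (ContinuousLinearMap.adjoint X (basisVec i))).summable (by norm_num)
  simpa using this

theorem RowsIn.isHilbertSchmidt {F : Finset ℤ} {X : Op} (h : RowsIn F X) :
    IsHilbertSchmidt X := by
  have h1 : ∀ n : ℤ, ‖X (basisVec n)‖ ^ 2 = ∑ i ∈ F, ‖entry X i n‖ ^ 2 := fun n => by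
    have h2 := lp.norm_rpow_eq_tsum (p := 2) (by norm_num) (X (basisVec n))
    rw [tsum_eq_sum (s := F) fun i hi => by rw [h _ i hi]; simp] at h2
    simpa [entry] using h2
  unfold IsHilbertSchmidt
  simp_rw [h1]
  exact summable_sum fun i _ => summable_norm_entry_sq X i

theorem RowsIn.isTraceClass {F : Finset ℤ} {X : Op} (h : RowsIn F X) : IsTraceClass X :=
  ⟨proj F, X, (rowsIn_proj F).isHilbertSchmidt, h.isHilbertSchmidt, h.proj_mul.symm⟩

theorem ColsIn.isTraceClass {F : Finset ℤ} {X : Op} (h : ColsIn F X) : IsTraceClass X :=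
  ⟨X, proj F, h.isHilbertSchmidt, (rowsIn_proj F).isHilbertSchmidt, h.mul_proj.symm⟩

theorem RowsIn.trace_eq {F : Finset ℤ} {X : Op} (h : RowsIn F X) :
    trace X = (compress F X).trace := by
  unfold trace
  rw [tsum_eq_sum (s := F) (f := fun n => entry X n n) fun n hn => h _ n hn]
  exact (Finset.sum_coe_sort F fun n => entry X n n).symm

/-! ### Determinants -/

/-- The minors not contained in `F` drop out, and those remaining form the principal minor expansion
of a finite determinant. -/
theorem detOneAdd_eq_det_compress {F : Finset ℤ} {X : Op}
    (h : ∀ S : Finset ℤ, ¬ S ⊆ F → (Matrix.of fun i j : S => entry X i j).det = 0) :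
    detOneAdd X = (1 + compress F X).det := by
  unfold detOneAdd
  rw [tsum_eq_sum (s := F.powerset) fun S hS => h S (by simpa using hS),
    Matrix.det_one_add_eq_sum_minors]
  symm
  refine Finset.sum_bij' (fun s _ => s.map (Function.Embedding.subtype _))
    (fun S _ => S.subtype (· ∈ F)) ?_ (fun _ _ => Finset.mem_univ _) ?_ ?_ ?_
  · intro s _
    rw [Finset.mem_powerset]
    exact Finset.map_subtype_subset s
  · intro s _
    ext x
    simp
  · intro S hS
    rw [Finset.mem_powerset] at hS
    ext x
    simpa using fun hx => hS hx
  · intro s _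
    let e : s ≃ s.map (Function.Embedding.subtype (· ∈ F)) := Equiv.ofBijective
      (fun x => ⟨x.1.1, Finset.mem_map_of_mem (Function.Embedding.subtype (· ∈ F)) x.2⟩)
      ⟨fun x y hxy => Subtype.ext (Subtype.ext (Subtype.mk.inj hxy)), fun ⟨y, hy⟩ => by
        obtain ⟨x, hx, rfl⟩ := Finset.mem_map.mp hy
        exact ⟨⟨x, hx⟩, rfl⟩⟩
    exact Matrix.det_submatrix_equiv_self e (Matrix.of fun i j => entry X i j)

theorem RowsIn.detOneAdd_eq {F : Finset ℤ} {X : Op} (h : RowsIn F X) :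
    detOneAdd X = (1 + compress F X).det := by
  refine detOneAdd_eq_det_compress fun S hS => ?_
  obtain ⟨i, hi, hiF⟩ := Finset.not_subset.mp hS
  exact Matrix.det_eq_zero_of_row_eq_zero ⟨i, hi⟩ fun j => h _ i hiF

theorem ColsIn.detOneAdd_eq {F : Finset ℤ} {X : Op} (h : ColsIn F X) :
    detOneAdd X = (1 + compress F X).det := by
  refine detOneAdd_eq_det_compress fun S hS => ?_
  obtain ⟨j, hj, hjF⟩ := Finset.not_subset.mp hS
  refine Matrix.det_eq_zero_of_column_eq_zero ⟨j, hj⟩ fun i => ?_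
  change X (basisVec j) i = 0
  rw [h j hjF]
  rfl

/-- Z = X + Y + XY again has its rows in `F`, where compression is multiplicative. -/
theorem RowsIn.detOneAdd_mul {F : Finset ℤ} {X Y Z : Op} (hX : RowsIn F X) (hY : RowsIn F Y)
    (hZ : 1 + Z = (1 + X) * (1 + Y)) : detOneAdd Z = detOneAdd X * detOneAdd Y := by
  have hZ' : Z = X + Y + X * Y := by
    rw [eq_sub_of_add_eq' hZ]; noncomm_ring
  have hZr : RowsIn F Z := by
    rw [hZ']; exact (hX.add hY).add (hX.mul_right Y)
  rw [hZr.detOneAdd_eq, hX.detOneAdd_eq, hY.detOneAdd_eq, ← Matrix.det_mul, hZ', compress_add,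
    compress_add, compress_mul X hY]
  congr 1
  noncomm_ring

theorem RowsIn.detOneAdd_mul_comm {F : Finset ℤ} {X Y : Op} (hX : RowsIn F X) (hY : RowsIn F Y) :
    detOneAdd (X * Y) = detOneAdd (Y * X) := by
  rw [(hX.mul_right Y).detOneAdd_eq, (hY.mul_right X).detOneAdd_eq, compress_mul X hY,
    compress_mul Y hX, Matrix.det_one_add_mul_comm]

/-- `det (I + U V) = det (I + V U)` when `V` acts within finitely many coordinates. -/
theorem detOneAdd_mul_comm_of_rowsIn_of_colsIn {F : Finset ℤ} (U : Op) {V : Op} (hr : RowsIn F V)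
    (hc : ColsIn F V) : detOneAdd (U * V) = detOneAdd (V * U) := by
  rw [(hc.mul_left U).detOneAdd_eq, (hr.mul_right U).detOneAdd_eq, compress_mul U hr,
    Matrix.det_one_add_mul_comm]
  -- `U` is arbitrary; inserting `proj F` gives the right factor its rows in `F`, as `compress_mul`
  -- requires.
  rw [show V * U = V * (proj F * U) by rw [← mul_assoc, hc.mul_proj], compress_mul V ((rowsIn_proj F).mul_right U), compress_proj_mul]

/-- Invariance of the determinant under conjugation. -/
theorem RowsIn.detOneAdd_conj {F G : Finset ℤ} (hFG : F ⊆ G) {N U V : Op} (hN : RowsIn F N)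
    (hU : RowsIn G (U * proj F)) (hVU : V * U = 1) : detOneAdd (U * N * V) = detOneAdd N := by
  -- Both factors have rows in `G`. Exchanging them cancels V U and leaves N · proj F, which has the
  -- same compression as N.
  have h1 : U * N * V = (U * proj F) * (N * V) := by
    rw [mul_assoc, mul_assoc, ← mul_assoc (proj F), hN.proj_mul]
  have h2 : (N * V) * (U * proj F) = N * proj F := by
    rw [mul_assoc, ← mul_assoc V, hVU, one_mul]
  rw [h1, RowsIn.detOneAdd_mul_comm hU ((hN.mono hFG).mul_right V), h2,
    (hN.mul_right _).detOneAdd_eq, compress_mul_proj, hN.detOneAdd_eq]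

/-! ### The regularized determinant -/

/-- Every power X^k with k ≥ 1 has its rows in `F`, so at other coordinates only the constant term
of the series survives. -/
theorem RowsIn.exp_sub_one {F : Finset ℤ} {X : Op} (h : RowsIn F X) :
    RowsIn F (NormedSpace.exp X - 1) := fun f n hn => by
  have h1 := (NormedSpace.exp_series_hasSum_exp' (𝕂 := ℂ) X).mapL (coordCLM f n)
  have h2 := hasSum_single (f := fun k : ℕ => coordCLM f n ((k.factorial⁻¹ : ℂ) • X ^ k)) 0
    fun k hk => by
      obtain ⟨m, rfl⟩ := Nat.exists_eq_succ_of_ne_zero hk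
      rw [map_smul, pow_succ']
      rw [show coordCLM f n (X * X ^ m) = 0 from h.mul_right (X ^ m) f n hn, smul_zero]
  have h3 := h1.unique h2
  change NormedSpace.exp X f n - f n = 0
  rw [sub_eq_zero]
  simpa using h3

theorem RowsIn.compress_pow {F : Finset ℤ} {X : Op} (h : RowsIn F X) (k : ℕ) :
    compress F (X ^ k) = compress F X ^ k := by
  induction k with
  | zero => rw [pow_zero, pow_zero, compress_one]
  | succ k ih => rw [pow_succ, compress_mul _ h, ih, pow_succ]

section
attribute [local instance] Matrix.linftyOpNormedRing Matrix.linftyOpNormedAlgebra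

theorem RowsIn.compress_exp {F : Finset ℤ} {X : Op} (h : RowsIn F X) :
    compress F (NormedSpace.exp X) = NormedSpace.exp (compress F X) := by
  have h1 := (NormedSpace.exp_series_hasSum_exp' (𝕂 := ℂ) X).map
    (AddMonoidHom.mk' (compress F) (compress_add F)) (continuous_compress F)
  have h2 := NormedSpace.exp_series_hasSum_exp' (𝕂 := ℂ) (compress F X)
  refine h1.unique (h2.congr_fun fun k => ?_)
  change compress F ((k.factorial⁻¹ : ℂ) • X ^ k) = _
  rw [compress_smul, h.compress_pow]

end

theorem R₂_eq (A : Op) :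
    R₂ A = A * (NormedSpace.exp (-A) - 1) + A + (NormedSpace.exp (-A) - 1) := by
  unfold R₂; noncomm_ring

theorem RowsIn.R₂ {F : Finset ℤ} {A : Op} (h : RowsIn F A) : RowsIn F (R₂ A) := by
  rw [R₂_eq]
  exact ((h.mul_right _).add h).add h.neg.exp_sub_one

/-- On compressions, 1 + R₂(A) = (1 + A) exp(-A), so `Matrix.det_exp` applies. -/
theorem RowsIn.det₂OneAdd_eq {F : Finset ℤ} {A : Op} (h : RowsIn F A) :
    det₂OneAdd A = detOneAdd A * Complex.exp (-trace A) := by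
  unfold det₂OneAdd
  rw [h.R₂.detOneAdd_eq, R₂_eq, compress_add, compress_add, compress_mul A h.neg.exp_sub_one,
    compress_sub, h.neg.compress_exp, compress_neg, compress_one, h.detOneAdd_eq, h.trace_eq,
    ← Matrix.trace_neg, ← Matrix.det_exp, ← Matrix.det_mul]
  congr 1
  noncomm_ring

/-! ### The inverse of the Joukowski map on the upper half-plane -/

/-- `(w - √(w² - 4)) / 2`. -/
def joukInv (w : ℂ) : ℂ := (w - sqrtPos (w ^ 2 - 4)) / 2

theorem lam0_eq (z : ℂ) : lam0 z = joukInv z := rfl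

theorem lam_eq (v : ℤ → ℝ) (z : ℂ) (n : ℤ) : lam v z n = joukInv (z - v n) := rfl

theorem lam_eq_lam0 {v : ℤ → ℝ} {n : ℤ} (h : v n = 0) (z : ℂ) : lam v z n = lam0 z := by
  rw [lam_eq, lam0_eq, h, Complex.ofReal_zero, sub_zero]

/-- The two factors are the roots of x² - wx + 1. This relation is all that the operator
factorizations use about λ. -/
theorem joukInv_mul (w : ℂ) : joukInv w * (w - joukInv w) = 1 := by
  have h := sqrtPos_sq (w ^ 2 - 4)
  unfold joukInv
  linear_combination (-1 / 4 : ℂ) * h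

theorem joukInv_ne_zero (w : ℂ) : joukInv w ≠ 0 := left_ne_zero_of_mul_eq_one (joukInv_mul w)

/-- The imaginary part is the real part of the principal square root of -u, whose argument lies in
[-π/2, π/2]. -/
theorem sqrtPos_im_nonneg (u : ℂ) : 0 ≤ (sqrtPos u).im := by
  unfold sqrtPos
  rw [Complex.I_mul_im]
  by_cases h : -u = 0
  · rw [h, Complex.zero_cpow (by norm_num)]; simp
  · rw [Complex.cpow_def_of_ne_zero h, Complex.exp_re]
    refine mul_nonneg (Real.exp_pos _).le (Real.cos_nonneg_of_mem_Icc ?_)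
    have h1 : (Complex.log (-u) * (1 / 2)).im = (-u).arg / 2 := by
      rw [mul_one_div, ← Complex.log_im]
      simp
    rw [h1]
    have h2 := Complex.neg_pi_lt_arg (-u)
    have h3 := Complex.arg_le_pi (-u)
    constructor <;> linarith

theorem half_im_le_im_sub_joukInv (w : ℂ) : w.im / 2 ≤ (w - joukInv w).im := by
  have h := sqrtPos_im_nonneg (w ^ 2 - 4)
  have h1 : w - joukInv w = (w + sqrtPos (w ^ 2 - 4)) / 2 := by unfold joukInv; ring
  rw [h1, show ((w + sqrtPos (w ^ 2 - 4)) / 2).im = (w.im + (sqrtPos (w ^ 2 - 4)).im) / 2 by simp]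
  linarith

theorem norm_joukInv_le {w : ℂ} (hw : 0 < w.im) : ‖joukInv w‖ ≤ 2 / w.im := by
  have h1 := half_im_le_im_sub_joukInv w
  have h2 := Complex.abs_im_le_norm (w - joukInv w)
  have h3 : ‖joukInv w‖ * ‖w - joukInv w‖ = 1 := by rw [← norm_mul, joukInv_mul, norm_one]
  have h4 : w.im / 2 ≤ ‖w - joukInv w‖ := h1.trans ((le_abs_self _).trans h2)
  rw [le_div_iff₀ hw]
  have := mul_le_mul_of_nonneg_left h4 (norm_nonneg (joukInv w))
  linarith

/-- With b the other root, ab = 1 gives Im a = -|a|² Im b, so Im w = (1 - |a|²) Im b with Im w and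
Im b both positive. -/
theorem norm_joukInv_lt_one {w : ℂ} (hw : 0 < w.im) : ‖joukInv w‖ < 1 := by
  set a := joukInv w
  set b := w - joukInv w
  have h1 : 0 < b.im := (half_pos hw).trans_le (half_im_le_im_sub_joukInv w)
  have hab : a * b = 1 := joukInv_mul w
  have h2 : a.im = -(‖a‖ ^ 2 * b.im) := by
    have : (a * (starRingEnd ℂ a * starRingEnd ℂ b)).im = a.im := by
      rw [← map_mul, hab, map_one, mul_one]
    rw [← this, ← mul_assoc, Complex.mul_conj, Complex.normSq_eq_norm_sq, Complex.im_ofReal_mul,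
      Complex.conj_im, mul_neg]
  have h3 : w.im = a.im + b.im := by rw [← Complex.add_im]; congr 1; ring
  rw [h2] at h3
  have h4 : 0 < (1 - ‖a‖ ^ 2) * b.im := by linarith
  have h5 : 0 < 1 - ‖a‖ ^ 2 := (pos_iff_pos_of_mul_pos h4).mpr h1
  by_contra h
  nlinarith [not_lt.mp h]

theorem differentiableAt_joukInv {w : ℂ} (hw : 0 < w.im) : DifferentiableAt ℂ joukInv w := by
  -- On the imaginary axis 4 - w² is positive; elsewhere in the half-plane its imaginary part -2 Re
  -- w Im w is nonzero.
  have hs : -(w ^ 2 - 4) ∈ Complex.slitPlane := by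
    rw [Complex.mem_slitPlane_iff]
    by_cases h : w.re = 0
    · left
      simp [sq, h]
      positivity
    · right
      have h1 : (-(w ^ 2 - 4)).im = -(2 * (w.re * w.im)) := by simp [sq]; ring
      rw [h1]
      exact neg_ne_zero.mpr (mul_ne_zero two_ne_zero (mul_ne_zero h hw.ne'))
  unfold joukInv sqrtPos
  have h1 : DifferentiableAt ℂ (fun w : ℂ => (-(w ^ 2 - 4)) ^ (1 / 2 : ℂ)) w :=
    DifferentiableAt.cpow (by fun_prop) (by fun_prop) hs
  fun_prop

theorem tendsto_joukInv_sub (x : ℝ) :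
    Tendsto (fun z : ℂ => joukInv (z - x)) (comap Complex.im atTop) (𝓝 0) := by
  have h1 : Tendsto (fun z : ℂ => 2 / z.im) (comap Complex.im atTop) (𝓝 0) :=
    (tendsto_const_nhds.div_atTop tendsto_id).comp tendsto_comap
  refine squeeze_zero_norm' ?_ h1
  filter_upwards [tendsto_comap.eventually (eventually_gt_atTop (0 : ℝ))] with z hz
  have h2 : (z - x : ℂ).im = z.im := by simp
  simpa [h2] using norm_joukInv_le (w := z - x) (by rwa [h2])

/-! ### Shifts and diagonal operators -/

@[simp] theorem L_apply (f : L2Z) (n : ℤ) : L f n = f (n + 1) := by rw [L_eq_translate]; rfl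

@[simp] theorem R_apply (f : L2Z) (n : ℤ) : R f n = f (n - 1) := rfl

theorem L_mul_R : L * R = 1 := by
  ext f n
  change L (R f) n = f n
  simp

theorem R_mul_L : R * L = 1 := by
  ext f n
  change R (L f) n = f n
  simp

theorem norm_translate_le (k : ℤ) : ‖translate k‖ ≤ 1 := by
  unfold translate
  exact LinearMap.mkContinuous_norm_le _ zero_le_one _

theorem norm_L_le : ‖L‖ ≤ 1 := L_eq_translate ▸ norm_translate_le 1

theorem norm_R_le : ‖R‖ ≤ 1 := norm_translate_le (-1)

theorem isUnit_L : IsUnit L := ⟨⟨L, R, L_mul_R, R_mul_L⟩, rfl⟩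

theorem isUnit_R : IsUnit R := ⟨⟨R, L, R_mul_L, L_mul_R⟩, rfl⟩

theorem norm_diag_le {a : ℤ → ℂ} {K : ℝ} (hK : 0 ≤ K) (h : ∀ n, ‖a n‖ ≤ K) : ‖diag a‖ ≤ K := by
  have h' : ∀ n, ‖a n • ContinuousLinearMap.id ℂ ℂ‖ ≤ K := fun n => by
    rw [norm_smul, ContinuousLinearMap.norm_id, mul_one]; exact h n
  unfold diag
  rw [dif_pos ⟨K, hK, h'⟩]
  exact lp.norm_mapCLM_le 2 _ hK h'

theorem norm_diag_lt_one {a : ℤ → ℂ} (ha : (Set.range a).Finite) (h : ∀ n, ‖a n‖ < 1) :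
    ‖diag a‖ < 1 := by
  obtain ⟨_, ⟨m, rfl⟩, hm⟩ := Set.exists_max_image _ norm ha (Set.range_nonempty a)
  exact (norm_diag_le (norm_nonneg _) fun n => hm _ ⟨n, rfl⟩).trans_lt (h m)

theorem isUnit_L_sub {X : Op} (hX : ‖X‖ < 1) : IsUnit (L - X) := by
  have h : L - X = L * (1 - R * X) := by rw [mul_sub, ← mul_assoc, L_mul_R, mul_one, one_mul]
  rw [h]
  refine isUnit_L.mul (isUnit_one_sub_of_norm_lt_one ((norm_mul_le _ _).trans_lt ?_))
  nlinarith [norm_R_le, norm_nonneg X]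

theorem isUnit_R_sub {X : Op} (hX : ‖X‖ < 1) : IsUnit (R - X) := by
  have h : R - X = R * (1 - L * X) := by rw [mul_sub, ← mul_assoc, R_mul_L, mul_one, one_mul]
  rw [h]
  refine isUnit_R.mul (isUnit_one_sub_of_norm_lt_one ((norm_mul_le _ _).trans_lt ?_))
  nlinarith [norm_L_le, norm_nonneg X]

theorem norm_smul_one_lt {c : ℂ} (hc : ‖c‖ < 1) : ‖c • (1 : Op)‖ < 1 := by
  refine lt_of_le_of_lt ?_ hc
  rw [norm_smul]
  exact mul_le_of_le_one_right (norm_nonneg _) ContinuousLinearMap.norm_id_le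

/-! ### Triangular operators -/

/-- A nonzero solution would grow like |c|^(-k) along `g`, which a bounded sequence cannot do. -/
theorem eq_zero_of_geometric {c : ℂ} (hc : ‖c‖ < 1) {f : L2Z} (g : ℕ → ℤ)
    (h : ∀ k, f (g k) = c * f (g (k + 1))) : f (g 0) = 0 := by
  have h1 : ∀ k, f (g 0) = c ^ k * f (g k) := fun k => by
    induction k with
    | zero => simp
    | succ k ih => rw [ih, h k, pow_succ, mul_assoc]
  have h2 : ∀ k, ‖f (g 0)‖ ≤ ‖c‖ ^ k * ‖f‖ := fun k => by
    rw [h1 k, norm_mul, norm_pow]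
    gcongr
    exact lp.norm_apply_le_norm (by norm_num) f _
  have h3 : Tendsto (fun k => ‖c‖ ^ k * ‖f‖) atTop (𝓝 0) := by
    simpa using (tendsto_pow_atTop_nhds_zero_of_lt_one (norm_nonneg c) hc).mul_const ‖f‖
  exact norm_le_zero_iff.mp (ge_of_tendsto' h3 h2)

/-- Column `j` solves f(n+1) = c f(n) for n < j, so following it towards -∞ forces f to vanish up to
and including n = j. The inverse is thus strictly lower triangular; that of R - c is the mirror
image. -/
theorem entry_inverse_L_sub {c : ℂ} (hc : ‖c‖ < 1) {i j : ℤ} (hij : i ≤ j) :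
    entry (Ring.inverse (L - c • (1 : Op))) i j = 0 := by
  set f : L2Z := Ring.inverse (L - c • (1 : Op)) (basisVec j) with hf
  have h : ∀ n, f (n + 1) - c * f n = basisVec j n := fun n => by
    have h1 : (L - c • (1 : Op)) f = basisVec j := by
      change ((L - c • (1 : Op)) * Ring.inverse (L - c • (1 : Op))) (basisVec j) = _
      rw [Ring.mul_inverse_cancel _ (isUnit_L_sub (norm_smul_one_lt hc))]; rfl
    rw [← h1]
    change _ = L f n - c * f n
    rw [L_apply]
  have h2 := eq_zero_of_geometric hc (f := f) (fun k => i - k) fun k => by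
    have h3 := h (i - (k + 1 : ℕ))
    rw [show i - ((k + 1 : ℕ) : ℤ) + 1 = i - k by push_cast; ring, basisVec_apply, if_neg (by push_cast; omega), sub_eq_zero] at h3
    exact h3
  simpa using! h2

theorem entry_inverse_R_sub {c : ℂ} (hc : ‖c‖ < 1) {i j : ℤ} (hij : j ≤ i) :
    entry (Ring.inverse (R - c • (1 : Op))) i j = 0 := by
  set f : L2Z := Ring.inverse (R - c • (1 : Op)) (basisVec j) with hf
  have h : ∀ n, f (n - 1) - c * f n = basisVec j n := fun n => by
    have h1 : (R - c • (1 : Op)) f = basisVec j := by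
      change ((R - c • (1 : Op)) * Ring.inverse (R - c • (1 : Op))) (basisVec j) = _
      rw [Ring.mul_inverse_cancel _ (isUnit_R_sub (norm_smul_one_lt hc))]; rfl
    rw [← h1]
    change _ = R f n - c * f n
    rw [R_apply]
  have h2 := eq_zero_of_geometric hc (f := f) (fun k => i + k) fun k => by
    have h3 := h (i + (k + 1 : ℕ))
    rw [show i + ((k + 1 : ℕ) : ℤ) - 1 = i + k by push_cast; ring, basisVec_apply, if_neg (by push_cast; omega), sub_eq_zero] at h3
    exact h3
  simpa using! h2

/-- Each nonempty principal minor is triangular with zero diagonal; only the empty minor, equal to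
1, contributes. -/
theorem detOneAdd_eq_one_of_lower {X : Op} (h : ∀ i j, i ≤ j → entry X i j = 0) :
    detOneAdd X = 1 := by
  rw [detOneAdd_eq_det_compress (F := ∅), Matrix.det_isEmpty]
  intro S hS
  rw [Finset.subset_empty, ← Ne, ← Finset.nonempty_iff_ne_empty] at hS
  obtain ⟨i, hi⟩ := hS
  have hT : (Matrix.of fun i j : S => entry X i j).IsLowerTriangular :=
    fun i j hij => h i j (Subtype.coe_le_coe.mpr (le_of_lt (OrderDual.toDual_lt_toDual.mp hij)))
  rw [Matrix.det_of_isLowerTriangular _ hT]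
  exact Finset.prod_eq_zero (Finset.mem_univ (⟨i, hi⟩ : S)) (h i i le_rfl)

theorem detOneAdd_eq_one_of_upper {X : Op} (h : ∀ i j, j ≤ i → entry X i j = 0) :
    detOneAdd X = 1 := by
  rw [detOneAdd_eq_det_compress (F := ∅), Matrix.det_isEmpty]
  intro S hS
  rw [Finset.subset_empty, ← Ne, ← Finset.nonempty_iff_ne_empty] at hS
  obtain ⟨i, hi⟩ := hS
  have hT : (Matrix.of fun i j : S => entry X i j).IsUpperTriangular :=
    fun i j hij => h i j (Subtype.coe_le_coe.mpr (le_of_lt hij))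
  rw [Matrix.det_of_isUpperTriangular hT]
  exact Finset.prod_eq_zero (Finset.mem_univ (⟨i, hi⟩ : S)) (h i i le_rfl)

/-! ### Evaluation of algebraic expressions in operators -/

theorem add_apply' (X Y : Op) (f : L2Z) (n : ℤ) : (X + Y) f n = X f n + Y f n := rfl

theorem sub_apply' (X Y : Op) (f : L2Z) (n : ℤ) : (X - Y) f n = X f n - Y f n := rfl

theorem neg_apply' (X : Op) (f : L2Z) (n : ℤ) : (-X) f n = -X f n := rfl

theorem smul_apply' (c : ℂ) (X : Op) (f : L2Z) (n : ℤ) : (c • X) f n = c * X f n := rfl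

theorem mul_apply' (X Y : Op) (f : L2Z) (n : ℤ) : (X * Y) f n = X (Y f) n := rfl

theorem one_apply' (f : L2Z) (n : ℤ) : (1 : Op) f n = f n := rfl

/-! ### Factorizations of the Schrödinger operator -/

theorem finite_range_potential {v : ℤ → ℝ} (hv : v.support.Finite) : (Set.range v).Finite :=
  ((hv.image v).insert 0).subset (Function.range_subset_insert_image_support v)

theorem finite_range_lam {v : ℤ → ℝ} (hv : v.support.Finite) (z : ℂ) :
    (Set.range (lam v z)).Finite := by
  refine ((finite_range_potential hv).image fun x : ℝ => joukInv (z - x)).subset ?_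
  rintro _ ⟨n, rfl⟩
  exact ⟨v n, ⟨n, rfl⟩, rfl⟩

theorem Lam_apply {v : ℤ → ℝ} (hv : v.support.Finite) (z : ℂ) (f : L2Z) (n : ℤ) :
    Lam v z f n = lam v z n * f n := diag_apply (finite_range_lam hv z) f n

theorem Om_apply {v : ℤ → ℝ} (hv : v.support.Finite) (z : ℂ) (f : L2Z) (n : ℤ) :
    Om v z f n = (lam v z (n + 1) - lam v z n) * f n := by
  refine diag_apply ?_ f n
  refine ((finite_range_lam hv z).image2 (fun a b => a - b) (finite_range_lam hv z)).subset ?_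
  rintro _ ⟨n, rfl⟩
  exact ⟨_, ⟨n + 1, rfl⟩, _, ⟨n, rfl⟩, rfl⟩

theorem H_apply {v : ℤ → ℝ} (hv : v.support.Finite) (f : L2Z) (n : ℤ) :
    H v f n = f (n + 1) + f (n - 1) + v n * f n := by
  have h : (Set.range fun n => (v n : ℂ)).Finite := by
    refine ((finite_range_potential hv).image ((↑) : ℝ → ℂ)).subset ?_
    rintro _ ⟨n, rfl⟩
    exact ⟨v n, ⟨n, rfl⟩, rfl⟩
  unfold H
  simp [diag_apply h]

theorem finite_support_zero : (0 : ℤ → ℝ).support.Finite := by simp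

theorem lam_mul_sub (v : ℤ → ℝ) (z : ℂ) (n : ℤ) :
    lam v z n * (z - v n - lam v z n) = 1 := joukInv_mul _

theorem lam0_mul_sub (z : ℂ) : lam0 z * (z - lam0 z) = 1 := joukInv_mul _

theorem lam0_ne_zero (z : ℂ) : lam0 z ≠ 0 := joukInv_ne_zero z

theorem norm_lam0_lt_one {z : ℂ} (hz : 0 < z.im) : ‖lam0 z‖ < 1 := norm_joukInv_lt_one hz

theorem norm_Lam_lt_one {v : ℤ → ℝ} (hv : v.support.Finite) {z : ℂ} (hz : 0 < z.im) :
    ‖Lam v z‖ < 1 :=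
  norm_diag_lt_one (finite_range_lam hv z) fun n => norm_joukInv_lt_one (by simpa using hz)

theorem isUnit_L_sub_Lam {v : ℤ → ℝ} (hv : v.support.Finite) {z : ℂ} (hz : 0 < z.im) :
    IsUnit (L - Lam v z) := isUnit_L_sub (norm_Lam_lt_one hv hz)

theorem isUnit_R_sub_Lam {v : ℤ → ℝ} (hv : v.support.Finite) {z : ℂ} (hz : 0 < z.im) :
    IsUnit (R - Lam v z) := isUnit_R_sub (norm_Lam_lt_one hv hz)

theorem isUnit_L_sub_lam0 {z : ℂ} (hz : 0 < z.im) : IsUnit (L - lam0 z • (1 : Op)) :=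
  isUnit_L_sub (norm_smul_one_lt (norm_lam0_lt_one hz))

theorem isUnit_R_sub_lam0 {z : ℂ} (hz : 0 < z.im) : IsUnit (R - lam0 z • (1 : Op)) :=
  isUnit_R_sub (norm_smul_one_lt (norm_lam0_lt_one hz))

theorem Om_mul_L {v : ℤ → ℝ} (hv : v.support.Finite) (z : ℂ) :
    Om v z * L = L * Lam v z - Lam v z * L := by
  ext f n
  simp only [sub_apply', mul_apply', L_apply, Om_apply hv, Lam_apply hv]
  ring

theorem R_mul_Om {v : ℤ → ℝ} (hv : v.support.Finite) (z : ℂ) :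
    R * Om v z = Lam v z * R - R * Lam v z := by
  ext f n
  simp only [sub_apply', mul_apply', R_apply, Om_apply hv, Lam_apply hv, sub_add_cancel]
  ring

theorem Lam_mul_H_sub {v : ℤ → ℝ} (hv : v.support.Finite) (z : ℂ) :
    Lam v z * (H v - z • (1 : Op)) =
      -(1 + Lam v z * Lam v z - Lam v z * L - Lam v z * R) := by
  ext f n
  simp only [add_apply', sub_apply', neg_apply', smul_apply', mul_apply', one_apply', L_apply,
    R_apply, H_apply hv, Lam_apply hv]
  linear_combination (-f n) * lam_mul_sub v z n

theorem H_sub_mul_Lam {v : ℤ → ℝ} (hv : v.support.Finite) (z : ℂ) :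
    (H v - z • (1 : Op)) * Lam v z =
      -(1 + Lam v z * Lam v z - L * Lam v z - R * Lam v z) := by
  ext f n
  simp only [add_apply', sub_apply', neg_apply', smul_apply', mul_apply', one_apply', L_apply,
    R_apply, H_apply hv, Lam_apply hv]
  linear_combination (-f n) * lam_mul_sub v z n

theorem lam0_smul_H_sub (z : ℂ) :
    (H 0 - z • (1 : Op)) =
      -(lam0 z)⁻¹ • ((L - lam0 z • (1 : Op)) * (R - lam0 z • (1 : Op))) := by
  have h := lam0_ne_zero z
  ext f n
  simp only [sub_apply', smul_apply', mul_apply', one_apply', L_apply, R_apply,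
    H_apply finite_support_zero, add_sub_cancel_right, Pi.zero_apply,
    Complex.ofReal_zero]
  field_simp
  linear_combination (-f n) * lam0_mul_sub z

theorem L_R_commute (c : ℂ) :
    (L - c • (1 : Op)) * (R - c • (1 : Op)) = (R - c • (1 : Op)) * (L - c • (1 : Op)) := by
  simp only [sub_mul, mul_sub, L_mul_R, R_mul_L, smul_mul_assoc, mul_smul_comm, one_mul, mul_one]
  module

theorem isUnit_H_zero_sub {z : ℂ} (hz : 0 < z.im) : IsUnit (H 0 - z • (1 : Op)) := by
  rw [lam0_smul_H_sub, ← Algebra.algebraMap_eq_smul_one, Algebra.smul_def]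
  exact ((isUnit_iff_ne_zero.mpr (neg_ne_zero.mpr (inv_ne_zero (lam0_ne_zero z)))).map _).mul
    ((Algebra.algebraMap_eq_smul_one (A := Op) (lam0 z) ▸ isUnit_L_sub_lam0 hz).mul
      (Algebra.algebraMap_eq_smul_one (A := Op) (lam0 z) ▸ isUnit_R_sub_lam0 hz))

theorem inverse_H_zero_sub {z : ℂ} (hz : 0 < z.im) :
    Ring.inverse (H 0 - z • (1 : Op)) = -lam0 z •
      (Ring.inverse (R - lam0 z • (1 : Op)) * Ring.inverse (L - lam0 z • (1 : Op))) := by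
  have hK := isUnit_H_zero_sub hz
  refine hK.mul_left_cancel ?_
  rw [Ring.mul_inverse_cancel _ hK, lam0_smul_H_sub, smul_mul_smul_comm, neg_mul_neg,
    inv_mul_cancel₀ (lam0_ne_zero z), one_smul, mul_assoc, ← mul_assoc (R - _),
    Ring.mul_inverse_cancel _ (isUnit_R_sub_lam0 hz), one_mul,
    Ring.mul_inverse_cancel _ (isUnit_L_sub_lam0 hz)]

/-- (L - Λ)(R - Λ) = 1 + Λ² - LΛ - ΛR has Λ on the wrong side of L; adding ΩL = LΛ - ΛL moves it to
the left. In `one_sub_opB_mul`, subtracting ΩL moves Λ to the right. -/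
theorem one_add_opA_mul {v : ℤ → ℝ} (hv : v.support.Finite) {z : ℂ} (hz : 0 < z.im) :
    (1 + opA v z) * ((L - Lam v z) * (R - Lam v z)) = -(Lam v z * (H v - z • (1 : Op))) := by
  have h : opA v z * ((L - Lam v z) * (R - Lam v z)) = Om v z * L := by
    unfold opA LInv RInv
    rw [mul_assoc, mul_assoc, ← mul_assoc (Ring.inverse (L - _)),
      Ring.inverse_mul_cancel _ (isUnit_L_sub_Lam hv hz), one_mul,
      Ring.inverse_mul_cancel _ (isUnit_R_sub_Lam hv hz), mul_one]
  rw [add_mul, one_mul, h, Om_mul_L hv, Lam_mul_H_sub hv, sub_mul, mul_sub, mul_sub, L_mul_R]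
  abel

theorem one_sub_opB_mul {v : ℤ → ℝ} (hv : v.support.Finite) {z : ℂ} (hz : 0 < z.im) :
    (1 + -opB v z) * ((R - Lam v z) * (L - Lam v z)) = -((H v - z • (1 : Op)) * Lam v z) := by
  have h : opB v z * ((R - Lam v z) * (L - Lam v z)) = Om v z * L := by
    unfold opB LInv RInv
    rw [mul_assoc, mul_assoc, ← mul_assoc (Ring.inverse (R - _)),
      Ring.inverse_mul_cancel _ (isUnit_R_sub_Lam hv hz), one_mul,
      Ring.inverse_mul_cancel _ (isUnit_L_sub_Lam hv hz), mul_one]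
  rw [add_mul, one_mul, neg_mul, h, Om_mul_L hv, H_sub_mul_Lam hv, sub_mul, mul_sub, mul_sub,
    R_mul_L]
  abel

/-- Because RL = LR = 1, RΩ + ΩL is the commutator of R - Λ and L - Λ, and each of its two products
cancels one pair of inverses. -/
theorem traceOp_eq {v : ℤ → ℝ} (hv : v.support.Finite) {z : ℂ} (hz : 0 < z.im) :
    traceOp v z = opA v z - opB v z := by
  have hL := isUnit_L_sub_Lam hv hz
  have hR := isUnit_R_sub_Lam hv hz
  have h : R * Om v z + Om v z * L =
      (R - Lam v z) * (L - Lam v z) - (L - Lam v z) * (R - Lam v z) := by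
    rw [R_mul_Om hv, Om_mul_L hv, sub_mul, sub_mul, mul_sub, mul_sub, mul_sub, mul_sub, L_mul_R,
      R_mul_L]
    abel
  have h1 : LInv v z * RInv v z * ((R - Lam v z) * (L - Lam v z)) = 1 := by
    unfold LInv RInv
    rw [mul_assoc, ← mul_assoc (Ring.inverse (R - _)), Ring.inverse_mul_cancel _ hR, one_mul,
      Ring.inverse_mul_cancel _ hL]
  have h2 : ((L - Lam v z) * (R - Lam v z)) * (RInv v z * LInv v z) = 1 := by
    unfold LInv RInv
    rw [mul_assoc, ← mul_assoc (R - _), Ring.mul_inverse_cancel _ hR, one_mul,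
      Ring.mul_inverse_cancel _ hL]
  unfold traceOp opA opB
  rw [h]
  calc _ = Om v z * L * ((LInv v z * RInv v z * ((R - Lam v z) * (L - Lam v z))) *
        (RInv v z * LInv v z) - LInv v z * RInv v z *
        (((L - Lam v z) * (R - Lam v z)) * (RInv v z * LInv v z))) := by noncomm_ring
    _ = _ := by rw [h1, h2]; noncomm_ring

/-! ### The determinant identities -/

/-- `F` contains the support of the potential and its left translate. -/
def Carries (F : Finset ℤ) (v : ℤ → ℝ) : Prop := ∀ n ∉ F, v n = 0 ∧ v (n + 1) = 0

theorem exists_carries {v : ℤ → ℝ} (hv : v.support.Finite) : ∃ F : Finset ℤ, Carries F v := by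
  refine ⟨hv.toFinset ∪ hv.toFinset.image (· - 1), fun n hn => ?_⟩
  rw [Finset.mem_union, not_or] at hn
  refine ⟨by simpa using hn.1, ?_⟩
  by_contra h
  exact hn.2 (Finset.mem_image.mpr ⟨n + 1, by simpa using h, by ring⟩)

/-- The neighbours of `F`. -/
def thicken (F : Finset ℤ) : Finset ℤ := F ∪ (F.image (· - 1) ∪ F.image (· + 1))

theorem subset_thicken (F : Finset ℤ) : F ⊆ thicken F := Finset.subset_union_left

theorem notMem_of_notMem_thicken {F : Finset ℤ} {n : ℤ} (h : n ∉ thicken F) :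
    n ∉ F ∧ n + 1 ∉ F ∧ n - 1 ∉ F := by
  unfold thicken at h
  simp only [Finset.mem_union, not_or, Finset.mem_image, not_exists, not_and] at h
  exact ⟨h.1, fun h' => h.2.1 _ h' (by ring), fun h' => h.2.2 _ h' (by ring)⟩

theorem rowsIn_L_mul_proj (F : Finset ℤ) : RowsIn (thicken F) (L * proj F) := fun f n hn => by
  rw [mul_apply', L_apply, proj_apply, if_neg (notMem_of_notMem_thicken hn).2.1]

theorem rowsIn_R_mul_proj (F : Finset ℤ) : RowsIn (thicken F) (R * proj F) := fun f n hn => by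
  rw [mul_apply', R_apply, proj_apply, if_neg (notMem_of_notMem_thicken hn).2.2]

theorem rowsIn_smul_one_mul_proj (F : Finset ℤ) (c : ℂ) :
    RowsIn (thicken F) (c • (1 : Op) * proj F) := fun f n hn => by
  rw [mul_apply', smul_apply', one_apply', proj_apply, if_neg (notMem_of_notMem_thicken hn).1,
    mul_zero]

theorem rowsIn_Om {v : ℤ → ℝ} (hv : v.support.Finite) {F : Finset ℤ} (hF : Carries F v)
    (z : ℂ) : RowsIn F (Om v z) := fun f n hn => by
  rw [Om_apply hv, lam_eq_lam0 (hF n hn).1, lam_eq_lam0 (hF n hn).2, sub_self, zero_mul]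

theorem rowsIn_opA {v : ℤ → ℝ} (hv : v.support.Finite) {F : Finset ℤ} (hF : Carries F v)
    (z : ℂ) : RowsIn F (opA v z) :=
  (((rowsIn_Om hv hF z).mul_right _).mul_right _).mul_right _

theorem rowsIn_opB {v : ℤ → ℝ} (hv : v.support.Finite) {F : Finset ℤ} (hF : Carries F v)
    (z : ℂ) : RowsIn F (opB v z) :=
  (((rowsIn_Om hv hF z).mul_right _).mul_right _).mul_right _

theorem rowsIn_lam0_sub_Lam {v : ℤ → ℝ} (hv : v.support.Finite) {F : Finset ℤ} (hF : Carries F v)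
    (z : ℂ) : RowsIn F (lam0 z • (1 : Op) - Lam v z) := fun f n hn => by
  rw [sub_apply', smul_apply', one_apply', Lam_apply hv, lam_eq_lam0 (hF n hn).1, sub_self]

theorem rowsIn_H_sub {v : ℤ → ℝ} (hv : v.support.Finite) {F : Finset ℤ} (hF : Carries F v) : RowsIn F (H v - H 0) := fun f n hn => by
  rw [sub_apply', H_apply hv, H_apply finite_support_zero, (hF n hn).1]
  simp

theorem colsIn_H_sub {v : ℤ → ℝ} (hv : v.support.Finite) {F : Finset ℤ} (hF : Carries F v) : ColsIn F (H v - H 0) := fun n hn => by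
  ext m
  change (H v - H 0) (basisVec n) m = 0
  rw [sub_apply', H_apply hv, H_apply finite_support_zero]
  have h : (v m : ℂ) * basisVec n m = 0 := by
    rw [basisVec_apply]
    split_ifs with h
    · rw [h, (hF n hn).1]; simp
    · rw [mul_zero]
  rw [h]
  simp

theorem rowsIn_Lam_div_sub {v : ℤ → ℝ} (hv : v.support.Finite) {F : Finset ℤ} (hF : Carries F v)
    (z : ℂ) : RowsIn F ((lam0 z)⁻¹ • Lam v z - 1) := fun f n hn => by
  rw [sub_apply', smul_apply', one_apply', Lam_apply hv, lam_eq_lam0 (hF n hn).1,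
    inv_mul_cancel_left₀ (lam0_ne_zero z), sub_self]

theorem detOneAdd_Lam_div {v : ℤ → ℝ} (hv : v.support.Finite) {F : Finset ℤ} (hF : Carries F v)
    (z : ℂ) :
    detOneAdd ((lam0 z)⁻¹ • Lam v z - 1) = ∏ n ∈ F, lam v z n / lam0 z := by
  rw [(rowsIn_Lam_div_sub hv hF z).detOneAdd_eq, compress_sub, compress_one, add_sub_cancel]
  have h : compress F ((lam0 z)⁻¹ • Lam v z) =
      Matrix.diagonal fun n : F => lam v z n / lam0 z := by
    ext i j
    change ((lam0 z)⁻¹ • Lam v z) (basisVec j) i = _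
    rw [smul_apply', Lam_apply hv, basisVec_apply, Matrix.diagonal_apply]
    by_cases hij : i = j
    · rw [if_pos hij, if_pos (congrArg Subtype.val hij)]; ring
    · rw [if_neg hij, if_neg fun h => hij (Subtype.ext h)]; ring
  rw [h, Matrix.det_diagonal]
  exact Finset.prod_coe_sort F fun n => lam v z n / lam0 z

theorem wkb_mul_prod {v : ℤ → ℝ} {F : Finset ℤ} (hF : Carries F v) (z : ℂ) : wkb v z * ∏ n ∈ F, lam v z n / lam0 z = 1 := by
  unfold wkb
  rw [finprod_eq_prod_of_mulSupport_subset (s := F), ← Finset.prod_mul_distrib]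
  · refine Finset.prod_eq_one fun n _ => ?_
    have h1 := lam0_ne_zero z
    have h2 : lam v z n ≠ 0 := joukInv_ne_zero _
    field_simp
  · intro n hn
    by_contra h
    exact hn (by simp only; rw [lam_eq_lam0 (hF n h).1, div_self (lam0_ne_zero z)])

theorem pert_eq (v : ℤ → ℝ) {z : ℂ} (hz : 0 < z.im) : pert v z = Ring.inverse (H 0 - z • (1 : Op)) * (H v - H 0) := by
  unfold pert
  rw [show H v - z • (1 : Op) = (H 0 - z • (1 : Op)) + (H v - H 0) by abel, mul_add,
    Ring.inverse_mul_cancel _ (isUnit_H_zero_sub hz), add_sub_cancel_left]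

theorem colsIn_pert {v : ℤ → ℝ} (hv : v.support.Finite) {F : Finset ℤ} (hF : Carries F v)
    {z : ℂ} (hz : 0 < z.im) : ColsIn F (pert v z) := by
  rw [pert_eq v hz]
  exact (colsIn_H_sub hv hF).mul_left _

/-- `pert` has finitely many columns rather than rows; exchanging its factors brings it under the
`RowsIn` calculus. -/
theorem pertDet_eq {v : ℤ → ℝ} (hv : v.support.Finite) {F : Finset ℤ} (hF : Carries F v)
    {z : ℂ} (hz : 0 < z.im) :
    pertDet v z = detOneAdd ((H v - H 0) * Ring.inverse (H 0 - z • (1 : Op))) := by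
  unfold pertDet
  rw [pert_eq v hz]
  exact detOneAdd_mul_comm_of_rowsIn_of_colsIn _ (rowsIn_H_sub hv hF) (colsIn_H_sub hv hF)

theorem one_add_perturbation (v : ℤ → ℝ) {z : ℂ} (hz : 0 < z.im) : 1 + (H v - H 0) * Ring.inverse (H 0 - z • (1 : Op)) =
    (H v - z • (1 : Op)) * Ring.inverse (H 0 - z • (1 : Op)) := by
  rw [show H v - z • (1 : Op) = (H 0 - z • (1 : Op)) + (H v - H 0) by abel, add_mul,
    Ring.mul_inverse_cancel _ (isUnit_H_zero_sub hz)]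

theorem detOneAdd_L_factor {v : ℤ → ℝ} (hv : v.support.Finite) {z : ℂ} (hz : 0 < z.im) :
    detOneAdd ((lam0 z • (1 : Op) - Lam v z) * Ring.inverse (L - lam0 z • (1 : Op))) = 1 := by
  refine detOneAdd_eq_one_of_lower fun i j hij => ?_
  change (lam0 z • (1 : Op) - Lam v z) (Ring.inverse (L - lam0 z • (1 : Op)) (basisVec j)) i = 0
  have h : Ring.inverse (L - lam0 z • (1 : Op)) (basisVec j) i = 0 :=
    entry_inverse_L_sub (norm_lam0_lt_one hz) hij
  rw [sub_apply', smul_apply', one_apply', Lam_apply hv, h]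
  ring

theorem detOneAdd_R_factor {v : ℤ → ℝ} (hv : v.support.Finite) {z : ℂ} (hz : 0 < z.im) :
    detOneAdd ((lam0 z • (1 : Op) - Lam v z) * Ring.inverse (R - lam0 z • (1 : Op))) = 1 := by
  refine detOneAdd_eq_one_of_upper fun i j hij => ?_
  change (lam0 z • (1 : Op) - Lam v z) (Ring.inverse (R - lam0 z • (1 : Op)) (basisVec j)) i = 0
  have h : Ring.inverse (R - lam0 z • (1 : Op)) (basisVec j) i = 0 :=
    entry_inverse_R_sub (norm_lam0_lt_one hz) hij
  rw [sub_apply', smul_apply', one_apply', Lam_apply hv, h]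
  ring

/-- (N + U)(N + W)W⁻¹U⁻¹ = (1 + NU⁻¹) · U(1 + NW⁻¹)U⁻¹, and both factors have determinant 1. It
serves with N = λ̃ - Λ and U, W equal to L - λ̃, R - λ̃ in either order. The larger set `G` makes
room for the conjugation by U. -/
theorem detOneAdd_eq_of_factor {F G : Finset ℤ} (hFG : F ⊆ G) {N U W A Z : Op} (hN : RowsIn F N)
    (hA : RowsIn G A) (hU : IsUnit U) (hW : IsUnit W) (hUF : RowsIn G (U * proj F))
    (hNU : detOneAdd (N * Ring.inverse U) = 1) (hNW : detOneAdd (N * Ring.inverse W) = 1)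
    (hZ : 1 + Z = (1 + A) * ((N + U) * (N + W)) * (Ring.inverse W * Ring.inverse U)) :
    detOneAdd Z = detOneAdd A := by
  have hconjr : RowsIn G (U * (N * Ring.inverse W) * Ring.inverse U) := by
    rw [← hN.proj_mul, mul_assoc (proj F), ← mul_assoc U]
    exact (hUF.mul_right _).mul_right _
  have hconj : detOneAdd (U * (N * Ring.inverse W) * Ring.inverse U) = 1 := by
    rw [RowsIn.detOneAdd_conj hFG (hN.mul_right _) hUF (Ring.inverse_mul_cancel _ hU), hNW]
  have h1 : (1 + N * Ring.inverse U) * (1 + U * (N * Ring.inverse W) * Ring.inverse U) =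
      ((N + U) * (N + W)) * (Ring.inverse W * Ring.inverse U) := by
    have h2 : 1 + N * Ring.inverse U = (N + U) * Ring.inverse U := by
      rw [add_mul, Ring.mul_inverse_cancel _ hU, add_comm]
    have h3 : 1 + U * (N * Ring.inverse W) * Ring.inverse U =
        U * ((N + W) * Ring.inverse W) * Ring.inverse U := by
      rw [add_mul, Ring.mul_inverse_cancel _ hW, mul_add, add_mul, mul_one,
        Ring.mul_inverse_cancel _ hU, add_comm]
    rw [h2, h3]
    simp only [mul_assoc]
    rw [← mul_assoc (Ring.inverse U) U, Ring.inverse_mul_cancel _ hU, one_mul]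
  have hNUr : RowsIn G (N * Ring.inverse U) := (hN.mono hFG).mul_right _
  set Y := (1 + N * Ring.inverse U) *
      (1 + U * (N * Ring.inverse W) * Ring.inverse U) - 1 with hY
  have hY1 : detOneAdd Y = 1 := by
    rw [RowsIn.detOneAdd_mul hNUr hconjr (show 1 + Y = _ from add_sub_cancel _ _), hconj,
      mul_one, hNU]
  have hYr : RowsIn G Y := by
    have : Y = N * Ring.inverse U + U * (N * Ring.inverse W) * Ring.inverse U +
        N * Ring.inverse U * (U * (N * Ring.inverse W) * Ring.inverse U) := by
      rw [hY]; noncomm_ring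
    rw [this]
    exact (hNUr.add hconjr).add (hNUr.mul_right _)
  rw [RowsIn.detOneAdd_mul hA hYr
    (show 1 + Z = (1 + A) * (1 + Y) by rw [hZ, hY, add_sub_cancel, h1, mul_assoc]), hY1, mul_one]

theorem detOneAdd_opA {v : ℤ → ℝ} (hv : v.support.Finite) {F : Finset ℤ} (hF : Carries F v)
    {z : ℂ} (hz : 0 < z.im) :
    detOneAdd (opA v z) = (∏ n ∈ F, lam v z n / lam0 z) * pertDet v z := by
  have hFG := subset_thicken F
  -- 1 + Z = λ̃⁻¹Λ(H - z)(H₀ - z)⁻¹, with the scalar λ̃⁻¹ chosen to match the free factorization.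
  set Z := (1 + ((lam0 z)⁻¹ • Lam v z - 1)) *
    (1 + (H v - H 0) * Ring.inverse (H 0 - z • (1 : Op))) - 1 with hZ
  have hZ1 : detOneAdd Z = (∏ n ∈ F, lam v z n / lam0 z) * pertDet v z := by
    rw [RowsIn.detOneAdd_mul (rowsIn_Lam_div_sub hv hF z) ((rowsIn_H_sub hv hF).mul_right _)
      (show 1 + Z = _ from add_sub_cancel _ _), detOneAdd_Lam_div hv hF, pertDet_eq hv hF hz]
  rw [← hZ1]
  symm
  refine detOneAdd_eq_of_factor hFG (rowsIn_lam0_sub_Lam hv hF z)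
    ((rowsIn_opA hv hF z).mono hFG) (isUnit_L_sub_lam0 hz) (isUnit_R_sub_lam0 hz) ?_
    (detOneAdd_L_factor hv hz) (detOneAdd_R_factor hv hz) ?_
  · rw [sub_mul]; exact (rowsIn_L_mul_proj F).sub (rowsIn_smul_one_mul_proj F _)
  · rw [show lam0 z • (1 : Op) - Lam v z + (L - lam0 z • (1 : Op)) = L - Lam v z by abel,
      show lam0 z • (1 : Op) - Lam v z + (R - lam0 z • (1 : Op)) = R - Lam v z by abel,
      one_add_opA_mul hv hz, hZ, add_sub_cancel, add_sub_cancel, one_add_perturbation v hz,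
      inverse_H_zero_sub hz, smul_mul_assoc, neg_smul, mul_neg, mul_neg, mul_smul_comm,
      mul_smul_comm, smul_neg, smul_smul, inv_mul_cancel₀ (lam0_ne_zero z), one_smul, neg_mul,
      mul_assoc]

theorem detOneAdd_neg_opB {v : ℤ → ℝ} (hv : v.support.Finite) {F : Finset ℤ} (hF : Carries F v)
    {z : ℂ} (hz : 0 < z.im) :
    detOneAdd (-opB v z) = (∏ n ∈ F, lam v z n / lam0 z) * pertDet v z := by
  have hFG := subset_thicken F
  have hK := isUnit_H_zero_sub hz
  have hKF : RowsIn (thicken F) ((H 0 - z • (1 : Op)) * proj F) := fun f n hn => by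
    have h := notMem_of_notMem_thicken hn
    rw [mul_apply', sub_apply', smul_apply', one_apply', H_apply finite_support_zero, proj_apply,
      proj_apply, proj_apply, if_neg h.1, if_neg h.2.1, if_neg h.2.2]
    ring
  set D := (lam0 z)⁻¹ • Lam v z - 1 with hD
  set K := H 0 - z • (1 : Op) with hKdef
  have hDr : RowsIn F D := rowsIn_Lam_div_sub hv hF z
  -- Here Λ stands to the right of H - z, so the diagonal factor enters conjugated by K = H₀ - z,
  -- which leaves its determinant unchanged.
  set Z := (1 + (H v - H 0) * Ring.inverse K) * (1 + K * D * Ring.inverse K) - 1 with hZ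
  have hconjr : RowsIn (thicken F) (K * D * Ring.inverse K) := by
    rw [← hDr.proj_mul, ← mul_assoc]
    exact (hKF.mul_right _).mul_right _
  have hZ1 : detOneAdd Z = (∏ n ∈ F, lam v z n / lam0 z) * pertDet v z := by
    rw [RowsIn.detOneAdd_mul (((rowsIn_H_sub hv hF).mono hFG).mul_right _) hconjr
      (show 1 + Z = _ from add_sub_cancel _ _), mul_comm, ← pertDet_eq hv hF hz,
      RowsIn.detOneAdd_conj hFG hDr hKF (Ring.inverse_mul_cancel _ hK), detOneAdd_Lam_div hv hF]
  -- The shifts now play exchanged roles, so the free inverses are needed in the opposite order.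
  have hcomm : Ring.inverse (R - lam0 z • (1 : Op)) * Ring.inverse (L - lam0 z • (1 : Op)) =
      Ring.inverse (L - lam0 z • (1 : Op)) * Ring.inverse (R - lam0 z • (1 : Op)) := by
    have h : Commute (R - lam0 z • (1 : Op)) (L - lam0 z • (1 : Op)) := (L_R_commute _).symm
    exact h.ringInverse_ringInverse
  have hfac : 1 + Z = (H v - z • (1 : Op)) * ((lam0 z)⁻¹ • Lam v z) * Ring.inverse K := by
    have h1 : 1 + K * D * Ring.inverse K = K * ((lam0 z)⁻¹ • Lam v z) * Ring.inverse K := by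
      rw [hD, mul_sub, sub_mul, mul_one, Ring.mul_inverse_cancel _ hK, add_sub_cancel]
    rw [hZ, add_sub_cancel, h1, one_add_perturbation v hz]
    simp only [mul_assoc]
    rw [← mul_assoc (Ring.inverse K) K, Ring.inverse_mul_cancel _ hK, one_mul]
  rw [← hZ1]
  symm
  refine detOneAdd_eq_of_factor hFG (rowsIn_lam0_sub_Lam hv hF z)
    ((rowsIn_opB hv hF z).neg.mono hFG) (isUnit_R_sub_lam0 hz) (isUnit_L_sub_lam0 hz) ?_
    (detOneAdd_R_factor hv hz) (detOneAdd_L_factor hv hz) ?_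
  · rw [sub_mul]; exact (rowsIn_R_mul_proj F).sub (rowsIn_smul_one_mul_proj F _)
  · rw [show lam0 z • (1 : Op) - Lam v z + (L - lam0 z • (1 : Op)) = L - Lam v z by abel,
      show lam0 z • (1 : Op) - Lam v z + (R - lam0 z • (1 : Op)) = R - Lam v z by abel,
      one_sub_opB_mul hv hz, hfac, hKdef, inverse_H_zero_sub hz, hcomm, mul_smul_comm,
      neg_smul, mul_smul_comm, smul_mul_assoc, smul_smul, mul_inv_cancel₀
      (lam0_ne_zero z), one_smul, neg_mul]

/-! ### Dependence on the spectral parameter -/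

/-- A finite sum of scalar functions times fixed operators: holomorphy and limits in operator norm
reduce to those of λ̃ and finitely many λ_n. -/
theorem Lam_eq_sum {v : ℤ → ℝ} (hv : v.support.Finite) {F : Finset ℤ} (hF : Carries F v) (z : ℂ) :
    Lam v z = lam0 z • (1 : Op) + ∑ n ∈ F, (lam v z n - lam0 z) • proj {n} := by
  ext f m
  rw [add_apply', smul_apply', one_apply', Lam_apply hv]
  have h : (∑ n ∈ F, (lam v z n - lam0 z) • proj {n}) f m =
      ∑ n ∈ F, if m = n then (lam v z n - lam0 z) * f m else 0 := by
    rw [← coordCLM_apply, map_sum]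
    refine Finset.sum_congr rfl fun n _ => ?_
    rw [coordCLM_apply, smul_apply', proj_apply]
    simp
  rw [h, Finset.sum_ite_eq]
  split_ifs with hm
  · ring
  · rw [lam_eq_lam0 (hF m hm).1, add_zero]

theorem differentiableAt_lam (v : ℤ → ℝ) (n : ℤ) {z : ℂ} (hz : 0 < z.im) :
    DifferentiableAt ℂ (fun z => lam v z n) z :=
  DifferentiableAt.comp (f := fun z : ℂ => z - v n) z (differentiableAt_joukInv (by simpa using hz))
    (differentiableAt_id.sub_const _)

theorem differentiableAt_Lam {v : ℤ → ℝ} (hv : v.support.Finite) {z : ℂ} (hz : 0 < z.im) :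
    DifferentiableAt ℂ (Lam v) z := by
  obtain ⟨F, hF⟩ := exists_carries hv
  rw [show Lam v = _ from funext (Lam_eq_sum hv hF)]
  have h0 : DifferentiableAt ℂ lam0 z := differentiableAt_joukInv hz
  exact (h0.smul_const _).add (DifferentiableAt.fun_sum fun n _ =>
    ((differentiableAt_lam v n hz).sub h0).smul_const _)

theorem tendsto_Lam {v : ℤ → ℝ} (hv : v.support.Finite) :
    Tendsto (Lam v) (comap Complex.im atTop) (𝓝 0) := by
  obtain ⟨F, hF⟩ := exists_carries hv
  rw [show Lam v = _ from funext (Lam_eq_sum hv hF)]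
  have h0 : Tendsto lam0 (comap Complex.im atTop) (𝓝 0) := by
    simpa [lam0_eq] using! tendsto_joukInv_sub 0
  have h1 : ∀ n ∈ F, Tendsto (fun z => (lam v z n - lam0 z) • proj {n})
      (comap Complex.im atTop) (𝓝 (((0 : ℂ) - 0) • proj {n})) := fun n _ =>
    ((tendsto_joukInv_sub (v n)).sub h0).smul_const _
  simpa using! (h0.smul_const (1 : Op)).add (tendsto_finsetSum F h1)

theorem opA_eq {v : ℤ → ℝ} (hv : v.support.Finite) (z : ℂ) :
    opA v z = (L * Lam v z - Lam v z * L) * Ring.inverse (R - Lam v z) *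
      Ring.inverse (L - Lam v z) := by rw [← Om_mul_L hv]; rfl

theorem opB_eq {v : ℤ → ℝ} (hv : v.support.Finite) (z : ℂ) :
    opB v z = (L * Lam v z - Lam v z * L) * Ring.inverse (L - Lam v z) *
      Ring.inverse (R - Lam v z) := by rw [← Om_mul_L hv]; rfl

section
variable {v : ℤ → ℝ}

theorem differentiableAt_opA (hv : v.support.Finite) {z : ℂ} (hz : 0 < z.im) :
    DifferentiableAt ℂ (opA v) z := by
  have h := differentiableAt_Lam hv hz
  rw [show opA v = _ from funext (opA_eq hv)]
  exact (((h.const_mul L).sub (h.mul_const L)).mul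
    ((h.const_sub R).inverse (isUnit_R_sub_Lam hv hz))).mul
    ((h.const_sub L).inverse (isUnit_L_sub_Lam hv hz))

theorem differentiableAt_opB (hv : v.support.Finite) {z : ℂ} (hz : 0 < z.im) :
    DifferentiableAt ℂ (opB v) z := by
  have h := differentiableAt_Lam hv hz
  rw [show opB v = _ from funext (opB_eq hv)]
  exact (((h.const_mul L).sub (h.mul_const L)).mul
    ((h.const_sub L).inverse (isUnit_L_sub_Lam hv hz))).mul
    ((h.const_sub R).inverse (isUnit_R_sub_Lam hv hz))

theorem tendsto_inverse_sub_Lam (hv : v.support.Finite) {S : Op} (hS : IsUnit S) :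
    Tendsto (fun z => Ring.inverse (S - Lam v z)) (comap Complex.im atTop)
      (𝓝 (Ring.inverse S)) := by
  obtain ⟨u, rfl⟩ := hS
  have h := (tendsto_Lam hv).const_sub (u : Op)
  rw [sub_zero] at h
  exact (NormedRing.inverse_continuousAt u).tendsto.comp h

theorem tendsto_opA (hv : v.support.Finite) :
    Tendsto (opA v) (comap Complex.im atTop) (𝓝 0) := by
  have h := tendsto_Lam hv
  rw [show opA v = _ from funext (opA_eq hv)]
  simpa using! (((h.const_mul L).sub (h.mul_const L)).mul
    (tendsto_inverse_sub_Lam hv isUnit_R)).mul (tendsto_inverse_sub_Lam hv isUnit_L)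

theorem tendsto_opB (hv : v.support.Finite) :
    Tendsto (opB v) (comap Complex.im atTop) (𝓝 0) := by
  have h := tendsto_Lam hv
  rw [show opB v = _ from funext (opB_eq hv)]
  simpa using! (((h.const_mul L).sub (h.mul_const L)).mul
    (tendsto_inverse_sub_Lam hv isUnit_L)).mul (tendsto_inverse_sub_Lam hv isUnit_R)

/-! ### The branch of the square root and the final identity. -/

/-- `det (I + A) exp (-(tr A - tr B) / 2)`, the distinguished square root of
`det₂ (I + A) det₂ (I - B)`. -/
def sqrtDet (v : ℤ → ℝ) (z : ℂ) : ℂ :=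
  detOneAdd (opA v z) * Complex.exp (-(1 / 2 * (trace (opA v z) - trace (opB v z))))

theorem sqrtDet_eq (hv : v.support.Finite) {F : Finset ℤ} (hF : Carries F v) (z : ℂ) :
    sqrtDet v z = (1 + compress F (opA v z)).det *
      Complex.exp (-(1 / 2 * ((compress F (opA v z)).trace - (compress F (opB v z)).trace))) := by
  unfold sqrtDet
  rw [(rowsIn_opA hv hF z).detOneAdd_eq, (rowsIn_opA hv hF z).trace_eq,
    (rowsIn_opB hv hF z).trace_eq]

theorem trace_traceOp (hv : v.support.Finite) {z : ℂ} (hz : 0 < z.im) :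
    trace (traceOp v z) = trace (opA v z) - trace (opB v z) := by
  obtain ⟨F, hF⟩ := exists_carries hv
  have hA := rowsIn_opA hv hF z
  have hB := rowsIn_opB hv hF z
  rw [traceOp_eq hv hz, (hA.sub hB).trace_eq, hA.trace_eq, hB.trace_eq, compress_sub,
    Matrix.trace_sub]

theorem differentiableOn_sqrtDet (hv : v.support.Finite) :
    DifferentiableOn ℂ (sqrtDet v) {z : ℂ | 0 < z.im} := by
  obtain ⟨F, hF⟩ := exists_carries hv
  rw [show sqrtDet v = _ from funext (sqrtDet_eq hv hF)]
  intro z hz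
  have hA : ∀ i j : F, DifferentiableAt ℂ (fun z => compress F (opA v z) i j) z := fun i j =>
    (coordCLM (basisVec j) i).differentiableAt.comp z (differentiableAt_opA hv hz)
  have hB : ∀ i j : F, DifferentiableAt ℂ (fun z => compress F (opB v z) i j) z := fun i j =>
    (coordCLM (basisVec j) i).differentiableAt.comp z (differentiableAt_opB hv hz)
  refine (DifferentiableAt.mul ?_ (DifferentiableAt.cexp (DifferentiableAt.neg
    (DifferentiableAt.const_mul (DifferentiableAt.sub ?_ ?_) _)))).differentiableWithinAt
  · simp only [Matrix.det_apply', Matrix.add_apply]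
    exact DifferentiableAt.fun_sum fun σ _ => DifferentiableAt.const_mul
      (DifferentiableAt.fun_finsetProd fun i _ => (hA _ _).const_add _) _
  · exact DifferentiableAt.fun_sum fun i _ => hA i i
  · exact DifferentiableAt.fun_sum fun i _ => hB i i

theorem tendsto_sqrtDet (hv : v.support.Finite) :
    Tendsto (sqrtDet v) (comap Complex.im atTop) (𝓝 1) := by
  obtain ⟨F, hF⟩ := exists_carries hv
  rw [show sqrtDet v = _ from funext (sqrtDet_eq hv hF)]
  have h0 : compress F 0 = 0 := rfl
  have hA := ((continuous_compress F).tendsto 0).comp (tendsto_opA hv)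
  have hB := ((continuous_compress F).tendsto 0).comp (tendsto_opB hv)
  rw [h0] at hA hB
  have hc : Continuous fun p : Matrix F F ℂ × Matrix F F ℂ =>
      (1 + p.1).det * Complex.exp (-(1 / 2 * (p.1.trace - p.2.trace))) := by fun_prop
  have h := (hc.tendsto (0, 0)).comp (hA.prodMk_nhds hB)
  simpa using! h

/-- The product of determinants is a perfect square because det(1 - B) = det(1 + A). -/
theorem sqrtDet_sq (hv : v.support.Finite) {z : ℂ} (hz : 0 < z.im) :
    sqrtDet v z ^ 2 = det₂Prod v z := by
  obtain ⟨F, hF⟩ := exists_carries hv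
  have hB := rowsIn_opB hv hF z
  have ht : trace (-opB v z) = -trace (opB v z) := by
    rw [hB.neg.trace_eq, hB.trace_eq, compress_neg, Matrix.trace_neg]
  unfold sqrtDet det₂Prod
  rw [(rowsIn_opA hv hF z).det₂OneAdd_eq, hB.neg.det₂OneAdd_eq, ht, neg_neg,
    detOneAdd_neg_opB hv hF hz, ← detOneAdd_opA hv hF hz, mul_pow, ← Complex.exp_nat_mul,
    mul_mul_mul_comm, ← Complex.exp_add, sq]
  congr 2
  push_cast
  ring

theorem isSqrtBranch_sqrtDet (hv : v.support.Finite) : IsSqrtBranch (det₂Prod v) (sqrtDet v) :=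
  ⟨differentiableOn_sqrtDet hv, fun _ hz => sqrtDet_sq hv hz, tendsto_sqrtDet hv⟩

theorem comap_im_neBot : (comap Complex.im atTop).NeBot :=
  atTop_neBot.comap_of_surj fun y => ⟨⟨0, y⟩, rfl⟩

/-- (s - t)(s + t) = 0 on a connected open set, so one analytic factor vanishes identically; s + t
tends to 2, which excludes it. -/
theorem IsSqrtBranch.unique {P s t : ℂ → ℂ} (hs : IsSqrtBranch P s) (ht : IsSqrtBranch P t)
    {z : ℂ} (hz : 0 < z.im) : s z = t z := by
  have hopen : IsOpen {z : ℂ | 0 < z.im} := isOpen_lt continuous_const Complex.continuous_im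
  have hconn : IsPreconnected {z : ℂ | 0 < z.im} := (convex_halfSpace_im_gt 0).isPreconnected
  have h := AnalyticOnNhd.eq_zero_or_eq_zero_of_mul_eq_zero
    ((hs.holomorphic.sub ht.holomorphic).analyticOnNhd hopen)
    ((hs.holomorphic.add ht.holomorphic).analyticOnNhd hopen)
    (fun w hw => by
      change (s w - t w) * (s w + t w) = 0
      linear_combination hs.sq_eq w hw - ht.sq_eq w hw) hconn
  rcases h with h | h
  · exact sub_eq_zero.mp (h z hz)
  · exfalso
    have := comap_im_neBot
    have h1 : Tendsto (fun w => s w + t w) (comap Complex.im atTop) (𝓝 (1 + 1)) :=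
      hs.tendsto_one.add ht.tendsto_one
    have h2 : Tendsto (fun w => s w + t w) (comap Complex.im atTop) (𝓝 0) := by
      refine tendsto_const_nhds.congr' ?_
      filter_upwards [tendsto_comap.eventually (eventually_gt_atTop (0 : ℝ))] with w hw
      exact (h w hw).symm
    have h3 := tendsto_nhds_unique h1 h2
    norm_num at h3

theorem pertDet_eq_wkb_mul (hv : v.support.Finite) {z : ℂ} (hz : 0 < z.im) :
    pertDet v z = wkb v z * detOneAdd (opA v z) := by
  obtain ⟨F, hF⟩ := exists_carries hv
  rw [detOneAdd_opA hv hF hz, ← mul_assoc, wkb_mul_prod hF, one_mul]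

theorem aMod_sqrtDet (hv : v.support.Finite) {z : ℂ} (hz : 0 < z.im) {s : ℂ → ℂ}
    (hs : s z = sqrtDet v z) : aMod v s z = detOneAdd (opA v z) := by
  unfold aMod
  rw [hs, trace_traceOp hv hz, sqrtDet, mul_left_comm, ← Complex.exp_add, add_neg_cancel,
    Complex.exp_zero, mul_one]

end

end JacobiDet

end

theorem mainTheorem3 (v : ℤ → ℝ) (hv : v.support.Finite) :
    (∀ z : ℂ, 0 < z.im →
      IsUnit (JacobiDet.H 0 - z • (1 : JacobiDet.Op)) ∧
      IsUnit (JacobiDet.L - JacobiDet.Lam v z) ∧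
      IsUnit (JacobiDet.R - JacobiDet.Lam v z) ∧
      JacobiDet.IsTraceClass (JacobiDet.pert v z) ∧
      JacobiDet.IsTraceClass (JacobiDet.traceOp v z) ∧
      JacobiDet.IsHilbertSchmidt (JacobiDet.opA v z) ∧
      JacobiDet.IsTraceClass (JacobiDet.R₂ (JacobiDet.opA v z)) ∧
      JacobiDet.IsHilbertSchmidt (JacobiDet.opB v z) ∧
      JacobiDet.IsTraceClass (JacobiDet.R₂ (-JacobiDet.opB v z))) ∧
    (∃ s : ℂ → ℂ, JacobiDet.IsSqrtBranch (JacobiDet.det₂Prod v) s) ∧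
    (∀ s : ℂ → ℂ, JacobiDet.IsSqrtBranch (JacobiDet.det₂Prod v) s →
      ∀ z : ℂ, 0 < z.im →
        JacobiDet.pertDet v z = JacobiDet.wkb v z * JacobiDet.aMod v s z) := by
  obtain ⟨F, hF⟩ := JacobiDet.exists_carries hv
  have hbranch := JacobiDet.isSqrtBranch_sqrtDet hv
  refine ⟨fun z hz => ?_, ⟨_, hbranch⟩, fun s hs z hz => ?_⟩
  · have hA := JacobiDet.rowsIn_opA hv hF z
    have hB := JacobiDet.rowsIn_opB hv hF z
    refine ⟨JacobiDet.isUnit_H_zero_sub hz, JacobiDet.isUnit_L_sub_Lam hv hz,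
      JacobiDet.isUnit_R_sub_Lam hv hz, (JacobiDet.colsIn_pert hv hF hz).isTraceClass, ?_,
      hA.isHilbertSchmidt, hA.R₂.isTraceClass, hB.isHilbertSchmidt, hB.neg.R₂.isTraceClass⟩
    rw [JacobiDet.traceOp_eq hv hz]
    exact (hA.sub hB).isTraceClass
  · rw [JacobiDet.pertDet_eq_wkb_mul hv hz, JacobiDet.aMod_sqrtDet hv hz (hs.unique hbranch hz)]
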